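/- **(Convergence on strongly convex functions.)** Let $\mathcal X\subseteq\mathbb R^d$ be a nonempty closed convex set of diameter at most $D$, where $0<D<\infty$, and let $g\colon\mathbb R^d\to\mathbb R$ be a Lipschitz convex function that is $\mu$-strongly convex on $\mathcal X$ for some $\mu>0$. Let $\varphi$ be equal to $g$ on $\mathcal X$ and to $+\infty$ off $\mathcal X$, and for $\alpha>0$ let $\varphi_\alpha(x)=\min_{y}\{\varphi(y)+\frac1{2\alpha}\|y-x\|^2\}$ be its Moreau envelope (a finite, differentiable function). Let $P$ be a probability measure on a measurable space $S$, let $U\supseteq\mathcal X$ be open, let $G\colon U\times S\to\mathbb R^d$ be measurable with $\mathbb E_{\xi\sim P}[G(x,\xi)]\in\partial g(x)$ for all $x\in U$, and let $L\ge 0$ satisfy $\mathbb E_{\xi\sim P}\|G(x,\xi)\|^2\le L^2$ for all $x\in\mathcal X$. For $x_0\in\mathcal X$, $m>0$, an integer $T\ge1$ and an oracle $H$, let $\mathrm{PSSM}(x_0,m,H,T)$ be the point $\frac{2}{T(T+1)}\sum_{t=0}^{T-1}(t+1)x_t$, where $x_{t+1}=\mathrm{proj}_{\mathcal X}\big(x_t-\frac{2}{m(t+1)}H(x_t,\xi_t)\big)$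 for $t=0,\dots,T-2$ and $\xi_t\sim P$ are fresh independent samples. *Gradual regularization.* Given $x_1\in\mathcal X$, $\lambda>0$ and integers $T\ge1$ and $\mathcal I\geq 0$, put $\mu_i=\mu2^i$, $\hat x_0=x_1$, $G^{(0)}=G$, and for $i=0,\dots,\mathcal I$ set $$\hat x_{i+1}=\mathrm{PSSM}\Big(\hat x_i,\sum_{j=0}^i\mu_j,G^{(i)},T\Big),\qquad G^{(i+1)}(x,\xi)=G^{(i)}(x,\xi)+\mu_{i+1}(x-\hat x_{i+1}),$$ with all samples, within and across stages, independent with law $P$. The output is $$\bar x=\frac{1}{\lambda+\sum_{i=1}^{\mathcal I}\mu_i}\Big(\lambda\hat x_{\mathcal I+1}+\sum_{i=1}^{\mathcal I}\mu_i\hat x_i\Big).$$ Suppose that $\log_2\big(1+\frac{\lambda}{2\mu}\big)$ is an integer and that $\mathcal I=\log_2\big(1+\frac{\lambda}{2\mu}\big)$. Then $$\mathbb E\big\|\nabla\varphi_{1/(2\lambda)}(\bar x)\big\|\le\frac{14\sqrt2\,\log_2\!\big(1+\tfrac{\lambda}{2\mu}\big)\sqrt{L^2+D^2\lambda^2}}{\sqrt{T+1}}.$$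 -/

import Mathlib

open MeasureTheory ProbabilityTheory

noncomputable section

namespace GradReg

/-- The (convex) subdifferential of `g` at `x`. -/
def subdifferential {d : ℕ} (g : EuclideanSpace ℝ (Fin d) → ℝ) (x : EuclideanSpace ℝ (Fin d)) :
    Set (EuclideanSpace ℝ (Fin d)) :=
  {v | ∀ y, g x + inner ℝ v (y - x) ≤ g y}

/-- The function equal to `g` on `X` and to `+∞` off `X`. -/
def extendTop {d : ℕ} (X : Set (EuclideanSpace ℝ (Fin d))) (g : EuclideanSpace ℝ (Fin d) → ℝ) :
    EuclideanSpace ℝ (Fin d) → EReal :=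
  open Classical in fun x => if x ∈ X then (g x : EReal) else ⊤

/-- The Moreau envelope `x ↦ inf_y {φ y + ‖y - x‖² / (2 lam)}` of an extended-real function. -/
def moreauEnvelope {d : ℕ} (φ : EuclideanSpace ℝ (Fin d) → EReal) (lam : ℝ)
    (x : EuclideanSpace ℝ (Fin d)) : EReal :=
  ⨅ y : EuclideanSpace ℝ (Fin d), φ y + ((1 / (2 * lam) * ‖y - x‖ ^ 2 : ℝ) : EReal)

/-- The nearest-point map of `X` (a nearest point exists and is unique when `X` is nonempty,
closed and convex). -/
def nearestPoint {d : ℕ} (X : Set (EuclideanSpace ℝ (Fin d))) (x : EuclideanSpace ℝ (Fin d)) :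
    EuclideanSpace ℝ (Fin d) :=
  Classical.epsilon fun y => y ∈ X ∧ ∀ z ∈ X, ‖x - y‖ ≤ ‖x - z‖

/-- The iterates of the projected stochastic subgradient method with strong convexity constant
`m`, oracle `G`, started at `x₀`, where step `t` uses the sample `ξ t`. -/
def pssmIter {d : ℕ} {S : Type*} (X : Set (EuclideanSpace ℝ (Fin d)))
    (x₀ : EuclideanSpace ℝ (Fin d)) (m : ℝ)
    (G : EuclideanSpace ℝ (Fin d) → S → EuclideanSpace ℝ (Fin d)) (ξ : ℕ → S) :
    ℕ → EuclideanSpace ℝ (Fin d)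
  | 0 => x₀
  | t + 1 =>
    nearestPoint X (pssmIter X x₀ m G ξ t -
      (2 / (m * ((t : ℝ) + 1))) • G (pssmIter X x₀ m G ξ t) (ξ t))

/-- The weighted average of the first `T` iterates `x_0, …, x_{T-1}` returned by the projected
stochastic subgradient method. -/
def pssm {d : ℕ} {S : Type*} (X : Set (EuclideanSpace ℝ (Fin d)))
    (x₀ : EuclideanSpace ℝ (Fin d)) (m : ℝ)
    (G : EuclideanSpace ℝ (Fin d) → S → EuclideanSpace ℝ (Fin d)) (T : ℕ) (ξ : ℕ → S) :
    EuclideanSpace ℝ (Fin d) :=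
  (2 / ((T : ℝ) * ((T : ℝ) + 1))) •
    ∑ t ∈ Finset.range T, ((t : ℝ) + 1) • pssmIter X x₀ m G ξ t

/-- The penalty parameters `μ_i = μ 2^i`. -/
def penalty (μ : ℝ) (i : ℕ) : ℝ := μ * 2 ^ i

/-- The pair (center `x̂_i`, oracle `G^{(i)}`) of gradual regularization at the start of stage `i`;
the `t`-th step of stage `i` uses the sample `ξ i t`. -/
def grState {d : ℕ} {S : Type*} (X : Set (EuclideanSpace ℝ (Fin d)))
    (x₁ : EuclideanSpace ℝ (Fin d)) (μ : ℝ) (T : ℕ)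
    (G : EuclideanSpace ℝ (Fin d) → S → EuclideanSpace ℝ (Fin d)) (ξ : ℕ → ℕ → S) :
    ℕ → EuclideanSpace ℝ (Fin d) × (EuclideanSpace ℝ (Fin d) → S → EuclideanSpace ℝ (Fin d))
  | 0 => (x₁, G)
  | i + 1 =>
    let xi := (grState X x₁ μ T G ξ i).1
    let Gi := (grState X x₁ μ T G ξ i).2
    let xnew := pssm X xi (∑ j ∈ Finset.range (i + 1), penalty μ j) Gi T (ξ i)
    (xnew, fun x s => Gi x s + penalty μ (i + 1) • (x - xnew))

/-- The centers `x̂_i`. -/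
def grCenter {d : ℕ} {S : Type*} (X : Set (EuclideanSpace ℝ (Fin d)))
    (x₁ : EuclideanSpace ℝ (Fin d)) (μ : ℝ) (T : ℕ)
    (G : EuclideanSpace ℝ (Fin d) → S → EuclideanSpace ℝ (Fin d)) (ξ : ℕ → ℕ → S) (i : ℕ) :
    EuclideanSpace ℝ (Fin d) :=
  (grState X x₁ μ T G ξ i).1

/-- The point returned by gradual regularization with stages `0, …, N`. -/
def gradualReg {d : ℕ} {S : Type*} (X : Set (EuclideanSpace ℝ (Fin d)))
    (x₁ : EuclideanSpace ℝ (Fin d)) (μ lam : ℝ) (T N : ℕ)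
    (G : EuclideanSpace ℝ (Fin d) → S → EuclideanSpace ℝ (Fin d)) (ξ : ℕ → ℕ → S) :
    EuclideanSpace ℝ (Fin d) :=
  (1 / (lam + ∑ i ∈ Finset.Icc 1 N, penalty μ i)) •
    (lam • grCenter X x₁ μ T G ξ (N + 1) +
      ∑ i ∈ Finset.Icc 1 N, penalty μ i • grCenter X x₁ μ T G ξ i)

/-- `G` is a stochastic subgradient oracle for `g`, with sampling law `P`, on an open set `U`
containing `X`, with second moment at most `L²` on `X`. Only the values of `G` on `U` matter. -/
structure IsStochasticOracle {d : ℕ} {S : Type*} [MeasurableSpace S] (P : Measure S)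
    (X U : Set (EuclideanSpace ℝ (Fin d))) (g : EuclideanSpace ℝ (Fin d) → ℝ)
    (G : EuclideanSpace ℝ (Fin d) → S → EuclideanSpace ℝ (Fin d)) (L : ℝ) : Prop where
  isOpen : IsOpen U
  subset : X ⊆ U
  measurable : Measurable fun p : U × S => G p.1 p.2
  integrable : ∀ x ∈ U, Integrable (G x) P
  mean_mem : ∀ x ∈ U, ∫ s, G x s ∂P ∈ subdifferential g x
  sq_integrable : ∀ x ∈ X, Integrable (fun s => ‖G x s‖ ^ 2) P
  second_moment : ∀ x ∈ X, ∫ s, ‖G x s‖ ^ 2 ∂P ≤ L ^ 2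

end GradReg

end

noncomputable section

namespace GradReg

/-! ### Nearest-point projection. -/

section Projection

variable {d : ℕ} {X : Set (EuclideanSpace ℝ (Fin d))}

/-! Stage `i` runs the stochastic method on `g` plus the quadratic penalties centred at `x̂_1, …,
x̂_i`. With `Λ_i` the sum of the first `i` penalties and `s_i` the weighted sum of their centres,
its objective is, up to a constant, `g + Λ_i/2 ‖x‖² - ⟪s_i, x⟫`, with minimizer `p_i`.

The choice of `N` gives `Λ_N = lam`, so the output is the midpoint of the last iterate and the mean
of the centres. Nonexpansiveness of the reflected prox bounds the envelope gradient there by `lam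
‖x̂_{N+1} - p_N‖ + ‖s_N - lam p_N‖` (`norm_gradient_moreauEnvelope_midpoint_le`). The last term is
at most `∑ μ_j ‖x̂_j - p_N‖`, which `sum_penalty_mul_norm_le` reduces to twice the sum of `μ_{j+1}
‖x̂_{j+1} - p_j‖`. So on every sample path the gradient is controlled by stage errors alone.

By `IsStochasticOracle.expectation_pssm`, the expected error of stage `i` is of order `1 / ((μ +
Λ_i) √(T+1))`. Since penalties double, `μ_{i+1} ≤ 2 (μ + Λ_i)`: every stage contributes the same
order, whence the factor `N`, the logarithm. -/

theorem nearestPoint_spec (hne : X.Nonempty) (hc : IsClosed X) (hconv : Convex ℝ X)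
    (u : EuclideanSpace ℝ (Fin d)) :
    nearestPoint X u ∈ X ∧
      ∀ z ∈ X, inner ℝ (u - nearestPoint X u) (z - nearestPoint X u) ≤ 0 := by
  have hex : ∃ y, y ∈ X ∧ ∀ z ∈ X, ‖u - y‖ ≤ ‖u - z‖ := by
    obtain ⟨y, hy, hmin⟩ := hc.exists_infDist_eq_dist hne u
    refine ⟨y, hy, fun z hz => ?_⟩
    rw [← dist_eq_norm, ← dist_eq_norm, ← hmin]
    exact Metric.infDist_le_dist_of_mem hz
  obtain ⟨hmem, hmin⟩ := Classical.epsilon_spec hex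
  refine ⟨hmem, (norm_eq_iInf_iff_real_inner_le_zero hconv hmem).1 ?_⟩
  have : Nonempty X := hne.to_subtype
  refine le_antisymm (le_ciInf fun z => hmin z z.2) ?_
  exact ciInf_le (f := fun z : X => ‖u - z‖) ⟨0, by rintro _ ⟨z, rfl⟩; exact norm_nonneg _⟩
    ⟨_, hmem⟩

theorem nearestPoint_mem (hne : X.Nonempty) (hc : IsClosed X) (hconv : Convex ℝ X)
    (u : EuclideanSpace ℝ (Fin d)) : nearestPoint X u ∈ X :=
  (nearestPoint_spec hne hc hconv u).1

theorem norm_nearestPoint_sub_le (hne : X.Nonempty) (hc : IsClosed X) (hconv : Convex ℝ X)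
    (u : EuclideanSpace ℝ (Fin d)) {z : EuclideanSpace ℝ (Fin d)} (hz : z ∈ X) :
    ‖nearestPoint X u - z‖ ≤ ‖u - z‖ := by
  have h := (nearestPoint_spec hne hc hconv u).2 z hz
  set p := nearestPoint X u
  have h1 : ‖u - z‖ ^ 2 = ‖u - p‖ ^ 2 - 2 * inner ℝ (u - p) (z - p) + ‖p - z‖ ^ 2 := by
    rw [show u - z = (u - p) - (z - p) by abel, norm_sub_sq_real, norm_sub_rev z p]
  nlinarith [norm_nonneg (u - z), norm_nonneg (p - z), sq_nonneg ‖u - p‖]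

theorem lipschitzWith_nearestPoint (hne : X.Nonempty) (hc : IsClosed X) (hconv : Convex ℝ X) :
    LipschitzWith 1 (nearestPoint X) := by
  refine LipschitzWith.of_dist_le_mul fun u v => ?_
  obtain ⟨hu, hu'⟩ := nearestPoint_spec hne hc hconv u
  obtain ⟨hv, hv'⟩ := nearestPoint_spec hne hc hconv v
  have h1 := hu' _ hv
  have h2 := hv' _ hu
  set p := nearestPoint X u
  set q := nearestPoint X v
  rw [dist_eq_norm, dist_eq_norm, NNReal.coe_one, one_mul]
  have h3 : ‖p - q‖ ^ 2 ≤ inner ℝ (u - v) (p - q) := by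
    have : inner ℝ (u - v) (p - q) - ‖p - q‖ ^ 2
        = -inner ℝ (u - p) (q - p) - inner ℝ (v - q) (p - q) := by
      rw [← real_inner_self_eq_norm_sq]
      simp only [inner_sub_left, inner_sub_right]
      ring
    linarith
  have h4 := real_inner_le_norm (u - v) (p - q)
  by_contra! hlt
  nlinarith [norm_nonneg (u - v), norm_nonneg (p - q)]

end Projection

/-! ### Minimizers of the regularized problems and their stability. -/

section Prox

variable {d : ℕ}

/-- First-order characterization, with the quadratic gain of strong convexity, of the minimizer
over `X` of `x ↦ g x + Λ / 2 * ‖x‖ ^ 2 - ⟪s, x⟫`. -/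
def IsProxPoint (X : Set (EuclideanSpace ℝ (Fin d))) (g : EuclideanSpace ℝ (Fin d) → ℝ)
    (μ Λ : ℝ) (s p : EuclideanSpace ℝ (Fin d)) : Prop :=
  p ∈ X ∧ ∀ y ∈ X, g p + inner ℝ (s - Λ • p) (y - p) + μ / 2 * ‖y - p‖ ^ 2 ≤ g y

/-- The minimizer over `X` of `x ↦ g x + Λ / 2 * ‖x‖ ^ 2 - ⟪s, x⟫`. -/
def proxPoint (X : Set (EuclideanSpace ℝ (Fin d))) (g : EuclideanSpace ℝ (Fin d) → ℝ)
    (μ Λ : ℝ) (s : EuclideanSpace ℝ (Fin d)) : EuclideanSpace ℝ (Fin d) :=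
  Classical.epsilon (IsProxPoint X g μ Λ s)

variable {X : Set (EuclideanSpace ℝ (Fin d))} {g : EuclideanSpace ℝ (Fin d) → ℝ} {μ Λ : ℝ}

/-- Passage to the limit `t → 0` in inequalities along a segment already divided by `t`. -/
theorem le_of_forall_le_add_mul {a b c : ℝ} (h : ∀ t : ℝ, 0 < t → t < 1 → a ≤ b + t * c) :
    a ≤ b := by
  have ht : Filter.Tendsto (fun t : ℝ => b + t * c) (nhdsWithin 0 (Set.Ioi 0)) (nhds b) := by
    have : Filter.Tendsto (fun t : ℝ => b + t * c) (nhds 0) (nhds (b + 0 * c)) :=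
      (Continuous.tendsto (by fun_prop) 0)
    rw [zero_mul, add_zero] at this
    exact this.mono_left nhdsWithin_le_nhds
  refine ge_of_tendsto ht ?_
  filter_upwards [Ioo_mem_nhdsGT (zero_lt_one' ℝ)] with t ht
  exact h t ht.1 ht.2

theorem _root_.StrongConvexOn.add_mul_sub_le (hg : StrongConvexOn X μ g)
    {x y : EuclideanSpace ℝ (Fin d)} (hx : x ∈ X) (hy : y ∈ X) {t : ℝ} (ht0 : 0 < t)
    (ht1 : t < 1) :
    x + t • (y - x) ∈ X ∧
      g (x + t • (y - x)) ≤ g x + t * (g y - g x) - t * (1 - t) * (μ / 2 * ‖y - x‖ ^ 2) := by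
  have e : x + t • (y - x) = (1 - t) • x + t • y := by module
  have h := hg.2 hx hy (by linarith : (0 : ℝ) ≤ 1 - t) ht0.le (by ring)
  rw [e, norm_sub_rev y x]
  refine ⟨hg.1 hx hy (by linarith) ht0.le (by ring), h.trans (le_of_eq ?_)⟩
  simp only [smul_eq_mul]
  ring

/-- The plain subgradient inequality at `x + t (y - x)`, combined with strong convexity on the
segment, gains the quadratic term as `t → 0`. -/
theorem strong_subgradient (hg : StrongConvexOn X μ g) {x y v : EuclideanSpace ℝ (Fin d)}
    (hx : x ∈ X) (hy : y ∈ X) (hv : v ∈ subdifferential g x) :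
    g x + inner ℝ v (y - x) + μ / 2 * ‖y - x‖ ^ 2 ≤ g y := by
  refine le_of_forall_le_add_mul (c := μ / 2 * ‖y - x‖ ^ 2) fun t ht0 ht1 => ?_
  have h1 := (hg.add_mul_sub_le hx hy ht0 ht1).2
  have h2 := hv (x + t • (y - x))
  rw [add_sub_cancel_left, real_inner_smul_right] at h2
  refine le_of_mul_le_mul_left ?_ ht0
  linarith

theorem exists_isProxPoint (hne : X.Nonempty) (hX : IsCompact X) (hgc : Continuous g)
    (hg : StrongConvexOn X μ g) (s : EuclideanSpace ℝ (Fin d)) :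
    ∃ p, IsProxPoint X g μ Λ s p := by
  obtain ⟨p, hp, hmin⟩ := hX.exists_isMinOn hne
    (f := fun x => g x + Λ / 2 * ‖x‖ ^ 2 - inner ℝ s x) (by fun_prop)
  refine ⟨p, hp, fun y hy => ?_⟩
  -- After comparing `p` with `p + t (y - p)` and dividing by `t`, the remainder of order `t` has a
  -- `μ` part from strong convexity and a `Λ` part from the quadratic.
  refine le_of_forall_le_add_mul (c := (μ / 2 + Λ / 2) * ‖y - p‖ ^ 2) fun t ht0 ht1 => ?_
  obtain ⟨hm, h1⟩ := hg.add_mul_sub_le hp hy ht0 ht1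
  have h2 : g p + Λ / 2 * ‖p‖ ^ 2 - inner ℝ s p ≤ _ := hmin hm
  simp only [norm_add_sq_real, inner_add_right, real_inner_smul_right, norm_smul,
    Real.norm_eq_abs, mul_pow, sq_abs] at h2
  rw [inner_sub_left, real_inner_smul_left]
  refine le_of_mul_le_mul_left ?_ ht0
  linarith

theorem isProxPoint_proxPoint (hne : X.Nonempty) (hX : IsCompact X) (hgc : Continuous g)
    (hg : StrongConvexOn X μ g) (s : EuclideanSpace ℝ (Fin d)) :
    IsProxPoint X g μ Λ s (proxPoint X g μ Λ s) :=
  Classical.epsilon_spec (exists_isProxPoint hne hX hgc hg s)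

/-- Each point is tested in the optimality condition of the other and the two are added, which
cancels the values of `g`. -/
theorem IsProxPoint.inner_ge {s s' p p' : EuclideanSpace ℝ (Fin d)}
    (h : IsProxPoint X g μ Λ s p) (h' : IsProxPoint X g μ Λ s' p') :
    (μ + Λ) * ‖p - p'‖ ^ 2 ≤ inner ℝ (s - s') (p - p') := by
  have h1 := h.2 _ h'.1
  have h2 := h'.2 _ h.1
  have e : inner ℝ (s - Λ • p) (p' - p) + inner ℝ (s' - Λ • p') (p - p')
      = Λ * ‖p - p'‖ ^ 2 - inner ℝ (s - s') (p - p') := by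
    rw [← real_inner_self_eq_norm_sq]
    simp only [inner_sub_left, inner_sub_right, real_inner_smul_left]
    ring
  rw [norm_sub_rev p' p] at h1
  linarith

theorem IsProxPoint.norm_sub_le (hm : 0 < μ + Λ) {s s' p p' : EuclideanSpace ℝ (Fin d)}
    (h : IsProxPoint X g μ Λ s p) (h' : IsProxPoint X g μ Λ s' p') :
    (μ + Λ) * ‖p - p'‖ ≤ ‖s - s'‖ := by
  have h1 := h.inner_ge h'
  have h2 := real_inner_le_norm (s - s') (p - p')
  by_contra! hlt
  have h3 : 0 < ‖p - p'‖ := by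
    by_contra! h0
    nlinarith [norm_nonneg (s - s')]
  nlinarith

/-- Makes the random minimizer of a stage measurable with respect to the past, since the centres
enter only through `s`. -/
theorem continuous_proxPoint (hne : X.Nonempty) (hX : IsCompact X) (hgc : Continuous g)
    (hg : StrongConvexOn X μ g) (hm : 0 < μ + Λ) : Continuous (proxPoint X g μ Λ) := by
  refine (LipschitzWith.of_dist_le_mul (K := Real.toNNReal (μ + Λ)⁻¹) fun s s' => ?_).continuous
  have h := (isProxPoint_proxPoint (Λ := Λ) hne hX hgc hg s).norm_sub_le hm
    (isProxPoint_proxPoint hne hX hgc hg s')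
  rw [dist_eq_norm, dist_eq_norm, Real.coe_toNNReal _ (inv_pos.2 hm).le, inv_mul_eq_div,
    le_div_iff₀ hm, mul_comm]
  exact h

/-- Strong monotonicity of the regularized subgradients relative to the minimizer. -/
theorem IsProxPoint.inner_subgradient_ge (hg : StrongConvexOn X μ g)
    {s p x v : EuclideanSpace ℝ (Fin d)} (h : IsProxPoint X g μ Λ s p) (hx : x ∈ X)
    (hv : v ∈ subdifferential g x) :
    (μ + Λ) * ‖x - p‖ ^ 2 ≤ inner ℝ (v + (Λ • x - s)) (x - p) := by
  have h1 := h.2 _ hx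
  have h2 := strong_subgradient hg hx h.1 hv
  have e : inner ℝ (s - Λ • p) (x - p) + inner ℝ v (p - x)
      = Λ * ‖x - p‖ ^ 2 - inner ℝ (v + (Λ • x - s)) (x - p) := by
    rw [← real_inner_self_eq_norm_sq]
    simp only [inner_sub_left, inner_add_left, inner_sub_right, real_inner_smul_left]
    ring
  rw [norm_sub_rev p x] at h2
  linarith

/-- Comparison of the minimizers before and after adding the penalty centered at `a`. -/
theorem IsProxPoint.add_penalty (hμ : 0 < μ) (hΛ : 0 ≤ Λ) {ν : ℝ} (hν : 0 < ν)
    {s a p q : EuclideanSpace ℝ (Fin d)} (hq : IsProxPoint X g μ Λ s q)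
    (hp : IsProxPoint X g μ (Λ + ν) (s + ν • a) p) :
    Λ * ‖q - p‖ ≤ ν * ‖a - p‖ ∧ ‖a - p‖ ≤ ‖a - q‖ := by
  have h1 := hp.2 _ hq.1
  have h2 := hq.2 _ hp.1
  have e : inner ℝ (s + ν • a - (Λ + ν) • p) (q - p) + inner ℝ (s - Λ • q) (p - q)
      = Λ * ‖q - p‖ ^ 2 + ν * inner ℝ (a - p) (q - p) := by
    rw [← real_inner_self_eq_norm_sq]
    simp only [inner_sub_left, inner_add_left, inner_sub_right, real_inner_smul_left]
    ring
  rw [norm_sub_rev p q] at h2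
  -- Cauchy–Schwarz turns this into the first claim. It also makes the angle at `p` between `a` and
  -- `q` at least right, which gives the second.
  have h3 : (μ + Λ) * ‖q - p‖ ^ 2 + ν * inner ℝ (a - p) (q - p) ≤ 0 := by linarith
  constructor
  · have h4 := (abs_le.1 (abs_real_inner_le_norm (a - p) (q - p))).1
    by_contra! hlt
    have h5 : 0 < ‖q - p‖ := by
      by_contra! h0
      nlinarith [norm_nonneg (a - p)]
    nlinarith [mul_pos hμ (pow_pos h5 2), mul_lt_mul_of_pos_right hlt h5]
  · have h4 : inner ℝ (a - p) (q - p) ≤ 0 := by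
      by_contra! hlt
      nlinarith [mul_pos hν hlt, sq_nonneg ‖q - p‖, mul_nonneg hΛ (sq_nonneg ‖q - p‖)]
    have h5 : ‖a - q‖ ^ 2 = ‖a - p‖ ^ 2 - 2 * inner ℝ (a - p) (q - p) + ‖q - p‖ ^ 2 := by
      rw [show a - q = (a - p) - (q - p) by abel, norm_sub_sq_real]
    nlinarith [norm_nonneg (a - q), norm_nonneg (a - p), sq_nonneg ‖q - p‖]

/-- Distances of the penalty centers to the last minimizer. -/
theorem sum_penalty_mul_norm_le (hμ : 0 < μ) {a p : ℕ → EuclideanSpace ℝ (Fin d)}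
    (hp : ∀ i, IsProxPoint X g μ (∑ j ∈ Finset.Icc 1 i, penalty μ j)
      (∑ j ∈ Finset.Icc 1 i, penalty μ j • a j) (p i)) (n : ℕ) :
    ∑ j ∈ Finset.Icc 1 n, penalty μ j * ‖a j - p n‖
      ≤ 2 * ∑ j ∈ Finset.range n, penalty μ (j + 1) * ‖a (j + 1) - p j‖ := by
  have hpos : ∀ i, 0 < penalty μ i := fun i => by unfold penalty; positivity
  -- The induction closes with errors measured to `p (j + 1)`; the new minimizer is no farther from
  -- the new centre than the old one, so `p j` can replace it.
  suffices h : ∑ j ∈ Finset.Icc 1 n, penalty μ j * ‖a j - p n‖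
      ≤ 2 * ∑ j ∈ Finset.range n, penalty μ (j + 1) * ‖a (j + 1) - p (j + 1)‖ by
    refine h.trans (mul_le_mul_of_nonneg_left (Finset.sum_le_sum fun j _ => ?_) zero_le_two)
    refine mul_le_mul_of_nonneg_left ?_ (hpos _).le
    have := hp (j + 1)
    rw [Finset.sum_Icc_succ_top (by omega), Finset.sum_Icc_succ_top (by omega)] at this
    exact ((hp j).add_penalty hμ (Finset.sum_nonneg fun i _ => (hpos i).le) (hpos _) this).2
  induction n with
  | zero => simp
  | succ n ih =>
    have h1 := hp (n + 1)
    rw [Finset.sum_Icc_succ_top (by omega), Finset.sum_Icc_succ_top (by omega)] at h1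
    have h2 := ((hp n).add_penalty hμ (Finset.sum_nonneg fun i _ => (hpos i).le) (hpos _) h1).1
    rw [Finset.sum_Icc_succ_top (by omega), Finset.sum_range_succ]
    -- The drift term is at most `penalty μ (n + 1) * ‖a (n + 1) - p (n + 1)‖` by `h2`, the same
    -- size as the new summand: hence the factor 2.
    have h3 : ∑ j ∈ Finset.Icc 1 n, penalty μ j * ‖a j - p (n + 1)‖
        ≤ ∑ j ∈ Finset.Icc 1 n, penalty μ j * ‖a j - p n‖
          + (∑ j ∈ Finset.Icc 1 n, penalty μ j) * ‖p n - p (n + 1)‖ := by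
      rw [Finset.sum_mul, ← Finset.sum_add_distrib]
      refine Finset.sum_le_sum fun j _ => ?_
      rw [← mul_add]
      exact mul_le_mul_of_nonneg_left (norm_sub_le_norm_sub_add_norm_sub _ _ _) (hpos j).le
    linarith

end Prox

/-! ### Gradient of the Moreau envelope. -/

section Envelope

variable {d : ℕ} {X : Set (EuclideanSpace ℝ (Fin d))} {g : EuclideanSpace ℝ (Fin d) → ℝ}
  {μ lam : ℝ}

theorem moreauEnvelope_eq_of_isProxPoint (hμ : 0 < μ) (hlam : 0 < lam)
    {x p : EuclideanSpace ℝ (Fin d)}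
    (hp : IsProxPoint X g μ (2 * lam) ((2 * lam) • x) p) :
    moreauEnvelope (extendTop X g) (1 / (2 * lam)) x = ((g p + lam * ‖p - x‖ ^ 2 : ℝ) : EReal) := by
  have e : 1 / (2 * (1 / (2 * lam))) = lam := by field_simp
  unfold moreauEnvelope
  rw [e]
  refine le_antisymm ((iInf_le _ p).trans (le_of_eq ?_)) (le_iInf fun y => ?_)
  · rw [extendTop, if_pos hp.1, ← EReal.coe_add]
  · by_cases hy : y ∈ X
    · rw [extendTop, if_pos hy, ← EReal.coe_add, EReal.coe_le_coe_iff]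
      have h := hp.2 y hy
      have e2 : ‖y - x‖ ^ 2 = ‖p - x‖ ^ 2 + 2 * inner ℝ (p - x) (y - p) + ‖y - p‖ ^ 2 := by
        rw [show y - x = (p - x) + (y - p) by abel, norm_add_sq_real]
      rw [← smul_sub, real_inner_smul_left, ← neg_sub p x, inner_neg_left] at h
      rw [e2]
      nlinarith [mul_nonneg hμ.le (sq_nonneg ‖y - p‖), mul_nonneg hlam.le (sq_nonneg ‖y - p‖)]
    · rw [extendTop, if_neg hy, EReal.top_add_coe]
      exact le_top

/-- The envelope is squeezed between its candidate linearization plus and minus `lam ‖y - x‖²`. The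
upper bound uses `P x` as a competitor at `y`; the lower one swaps `x` and `y` and uses that `P` is
nonexpansive. -/
theorem hasGradientAt_moreauEnvelope (hne : X.Nonempty) (hX : IsCompact X) (hgc : Continuous g)
    (hg : StrongConvexOn X μ g) (hμ : 0 < μ) (hlam : 0 < lam) (x : EuclideanSpace ℝ (Fin d)) :
    HasGradientAt (fun x => (moreauEnvelope (extendTop X g) (1 / (2 * lam)) x).toReal)
      ((2 * lam) • (x - proxPoint X g μ (2 * lam) ((2 * lam) • x))) x := by
  set P := fun x => proxPoint X g μ (2 * lam) ((2 * lam) • x) with hP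
  have hPx : ∀ x, IsProxPoint X g μ (2 * lam) ((2 * lam) • x) (P x) :=
    fun x => isProxPoint_proxPoint hne hX hgc hg _
  set e := fun x => (moreauEnvelope (extendTop X g) (1 / (2 * lam)) x).toReal with he
  have hex : ∀ x, e x = g (P x) + lam * ‖P x - x‖ ^ 2 := fun x => by
    simp only [he, moreauEnvelope_eq_of_isProxPoint hμ hlam (hPx x), EReal.toReal_coe]
  have hup : ∀ x y, e y ≤ e x + 2 * lam * inner ℝ (x - P x) (y - x) + lam * ‖y - x‖ ^ 2 := by
    intro x y
    have h := (hPx y).2 _ (hPx x).1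
    rw [hex, hex]
    have e1 : ‖P x - x‖ ^ 2 = ‖P x - y‖ ^ 2 + 2 * inner ℝ (P x - y) (y - x) + ‖y - x‖ ^ 2 := by
      rw [show P x - x = (P x - y) + (y - x) by abel, norm_add_sq_real]
    have e2 : ‖P x - y‖ ^ 2
        = ‖P y - y‖ ^ 2 + 2 * inner ℝ (P y - y) (P x - P y) + ‖P x - P y‖ ^ 2 := by
      rw [show P x - y = (P y - y) + (P x - P y) by abel, norm_add_sq_real]
    have e3 : inner ℝ (P x - y) (y - x) + inner ℝ (x - P x) (y - x) = -‖y - x‖ ^ 2 := by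
      rw [← real_inner_self_eq_norm_sq, ← inner_add_left, ← inner_neg_left]
      congr 1
      abel
    rw [← smul_sub, real_inner_smul_left, ← neg_sub (P y) y, inner_neg_left] at h
    nlinarith [mul_nonneg hμ.le (sq_nonneg ‖P x - P y‖), mul_nonneg hlam.le (sq_nonneg ‖P x - P y‖)]
  have hlow : ∀ y, -(lam * ‖y - x‖ ^ 2) ≤ e y - e x - 2 * lam * inner ℝ (x - P x) (y - x) := by
    intro y
    have h1 := hup y x
    have h2 : ‖P y - P x‖ ≤ ‖y - x‖ := by
      have := (hPx y).norm_sub_le (by linarith) (hPx x)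
      rw [← smul_sub, norm_smul, Real.norm_of_nonneg (by linarith : 0 ≤ 2 * lam)] at this
      have h3 : 2 * lam * ‖P y - P x‖ ≤ 2 * lam * ‖y - x‖ := by
        nlinarith [norm_nonneg (P y - P x)]
      exact le_of_mul_le_mul_left h3 (by linarith)
    have h3 := real_inner_le_norm (P y - P x) (y - x)
    have e1 : inner ℝ (y - P y) (x - y)
        = inner ℝ (P y - P x) (y - x) - ‖y - x‖ ^ 2 - inner ℝ (x - P x) (y - x) := by
      rw [← real_inner_self_eq_norm_sq]
      simp only [inner_sub_left, inner_sub_right]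
      ring
    rw [norm_sub_rev x y, e1] at h1
    have h4 : inner ℝ (P y - P x) (y - x) ≤ ‖y - x‖ ^ 2 := by
      nlinarith [norm_nonneg (y - x)]
    nlinarith
  rw [hasGradientAt_iff_isLittleO]
  refine Asymptotics.IsBigO.trans_isLittleO (g := fun y => ‖y - x‖ ^ 2) ?_ ?_
  · refine Asymptotics.IsBigO.of_bound lam (Filter.Eventually.of_forall fun y => ?_)
    rw [real_inner_smul_left, Real.norm_eq_abs, Real.norm_of_nonneg (sq_nonneg _), abs_le]
    have h1 := hup x y
    have h2 := hlow y
    constructor <;> linarith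
  · exact Asymptotics.isLittleO_norm_pow_id one_lt_two |>.comp_tendsto
      (k := fun y => y - x) (l' := nhds x) (by
        have : Continuous fun y : EuclideanSpace ℝ (Fin d) => y - x := by fun_prop
        simpa using this.tendsto x)

/-- The gradient of the envelope at the midpoint of a proximal center `c` and an approximation `b`
of the proximal point `p` of `c`. -/
theorem norm_gradient_moreauEnvelope_midpoint_le (hne : X.Nonempty) (hX : IsCompact X)
    (hgc : Continuous g) (hg : StrongConvexOn X μ g) (hμ : 0 < μ) (hlam : 0 < lam)
    {s b p : EuclideanSpace ℝ (Fin d)} (hp : IsProxPoint X g μ lam s p) :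
    ‖gradient (fun x => (moreauEnvelope (extendTop X g) (1 / (2 * lam)) x).toReal)
        ((1 / (2 * lam)) • (lam • b + s))‖ ≤ lam * ‖b - p‖ + ‖s - lam • p‖ := by
  rw [(hasGradientAt_moreauEnvelope hne hX hgc hg hμ hlam _).gradient]
  have h2 : (2 * lam) ≠ 0 := by positivity
  rw [smul_sub, smul_smul, mul_one_div_cancel h2, one_smul]
  set q := proxPoint X g μ (2 * lam) (lam • b + s)
  have hq : IsProxPoint X g μ (2 * lam) (lam • b + s) q := isProxPoint_proxPoint hne hX hgc hg _
  -- Adding `lam/2 ‖x - p‖²` to the objective does not move its minimizer `p`, so `p` and `q` solve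
  -- problems with the same curvature.
  have hp' : IsProxPoint X g μ (2 * lam) (lam • p + s) p := by
    refine ⟨hp.1, fun y hy => ?_⟩
    have := hp.2 y hy
    rwa [show lam • p + s - (2 * lam) • p = s - lam • p by module]
  have h := hq.inner_ge hp'
  rw [show lam • b + s - (lam • p + s) = lam • (b - p) by module] at h
  -- Nonexpansiveness of the reflected prox, from the strong monotonicity `h`.
  have h3 : ‖lam • (b - p) - (2 * lam) • (q - p)‖ ≤ ‖lam • (b - p)‖ := by
    have e : ‖lam • (b - p) - (2 * lam) • (q - p)‖ ^ 2 = ‖lam • (b - p)‖ ^ 2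
        - 4 * lam * inner ℝ (lam • (b - p)) (q - p) + 4 * lam ^ 2 * ‖q - p‖ ^ 2 := by
      rw [norm_sub_sq_real, real_inner_smul_right, norm_smul (2 * lam), mul_pow,
        Real.norm_eq_abs, sq_abs]
      ring
    refine le_of_sq_le_sq ?_ (norm_nonneg _)
    rw [e]
    have : 0 ≤ lam * (inner ℝ (lam • (b - p)) (q - p) - (μ + 2 * lam) * ‖q - p‖ ^ 2) :=
      mul_nonneg hlam.le (by linarith)
    nlinarith [mul_nonneg (mul_pos hlam hμ).le (sq_nonneg ‖q - p‖),
      mul_nonneg (sq_nonneg lam) (sq_nonneg ‖q - p‖)]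
  rw [norm_smul, Real.norm_of_nonneg hlam.le] at h3
  calc ‖lam • b + s - (2 * lam) • q‖
      = ‖(lam • (b - p) - (2 * lam) • (q - p)) + (s - lam • p)‖ := by congr 1; module
    _ ≤ _ := (norm_add_le _ _).trans (by linarith)

end Envelope

/-! ### Feasibility, averaging and measurability of the iterates. -/

section Iterates

variable {d : ℕ} {S : Type*} {X U : Set (EuclideanSpace ℝ (Fin d))}
  {G : EuclideanSpace ℝ (Fin d) → S → EuclideanSpace ℝ (Fin d)}

theorem pssmIter_mem (hne : X.Nonempty) (hc : IsClosed X) (hconv : Convex ℝ X)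
    {x₀ : EuclideanSpace ℝ (Fin d)} (hx₀ : x₀ ∈ X) (m : ℝ) (ξ : ℕ → S) (t : ℕ) :
    pssmIter X x₀ m G ξ t ∈ X := by
  cases t with
  | zero => exact hx₀
  | succ t => exact nearestPoint_mem hne hc hconv _

theorem sum_pssm_weights {T : ℕ} (hT : 1 ≤ T) :
    ∑ t ∈ Finset.range T, 2 / ((T : ℝ) * ((T : ℝ) + 1)) * ((t : ℝ) + 1) = 1 := by
  have h : ∀ n : ℕ, ∑ t ∈ Finset.range n, ((t : ℝ) + 1) = (n : ℝ) * ((n : ℝ) + 1) / 2 := by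
    intro n
    induction n with
    | zero => simp
    | succ n ih => rw [Finset.sum_range_succ, ih]; push_cast; ring
  have : (0 : ℝ) < T := by exact_mod_cast hT
  rw [← Finset.mul_sum, h]
  field_simp

theorem pssm_eq_sum (X : Set (EuclideanSpace ℝ (Fin d))) (x₀ : EuclideanSpace ℝ (Fin d)) (m : ℝ)
    (G : EuclideanSpace ℝ (Fin d) → S → EuclideanSpace ℝ (Fin d)) (T : ℕ) (ξ : ℕ → S) :
    pssm X x₀ m G T ξ = ∑ t ∈ Finset.range T,
      (2 / ((T : ℝ) * ((T : ℝ) + 1)) * ((t : ℝ) + 1)) • pssmIter X x₀ m G ξ t := by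
  simp only [pssm, Finset.smul_sum, smul_smul]

theorem pssm_mem (hne : X.Nonempty) (hc : IsClosed X) (hconv : Convex ℝ X)
    {x₀ : EuclideanSpace ℝ (Fin d)} (hx₀ : x₀ ∈ X) (m : ℝ) {T : ℕ} (hT : 1 ≤ T) (ξ : ℕ → S) :
    pssm X x₀ m G T ξ ∈ X := by
  rw [pssm_eq_sum]
  exact hconv.sum_mem (fun t _ => by positivity) (sum_pssm_weights hT)
    fun t _ => pssmIter_mem hne hc hconv hx₀ m ξ t

theorem norm_pssm_sub_sq_le (x₀ : EuclideanSpace ℝ (Fin d)) (m : ℝ) {T : ℕ} (hT : 1 ≤ T)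
    (ξ : ℕ → S) (z : EuclideanSpace ℝ (Fin d)) :
    ‖pssm X x₀ m G T ξ - z‖ ^ 2 ≤ ∑ t ∈ Finset.range T,
      2 / ((T : ℝ) * ((T : ℝ) + 1)) * ((t : ℝ) + 1) * ‖pssmIter X x₀ m G ξ t - z‖ ^ 2 := by
  have hcv : ConvexOn ℝ Set.univ fun x : EuclideanSpace ℝ (Fin d) => ‖x‖ ^ 2 :=
    (convexOn_norm convex_univ).pow (fun _ _ => norm_nonneg _) 2
  have h := hcv.map_sum_le (t := Finset.range T)
    (w := fun t : ℕ => 2 / ((T : ℝ) * ((T : ℝ) + 1)) * ((t : ℝ) + 1))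
    (p := fun t => pssmIter X x₀ m G ξ t - z) (fun t _ => by positivity) (sum_pssm_weights hT)
    (fun _ _ => Set.mem_univ _)
  simp only [smul_sub, Finset.sum_sub_distrib, ← Finset.sum_smul, sum_pssm_weights hT, one_smul,
    ← pssm_eq_sum, smul_eq_mul] at h
  exact h

variable [MeasurableSpace S] {Ω : Type*} [MeasurableSpace Ω]

theorem measurable_oracle_comp (hXU : X ⊆ U) (hG : Measurable fun p : U × S => G p.1 p.2)
    {Y : Ω → EuclideanSpace ℝ (Fin d)} (hY : Measurable Y) (hYX : ∀ ω, Y ω ∈ X) {η : Ω → S}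
    (hη : Measurable η) : Measurable fun ω => G (Y ω) (η ω) :=
  hG.comp ((hY.subtype_mk (h := fun ω => hXU (hYX ω))).prodMk hη)

/-- Only samples before `t` are assumed measurable, so the σ-algebra on `Ω` may be taken to be the
history before step `t`. -/
theorem measurable_pssmIter (hne : X.Nonempty) (hc : IsClosed X) (hconv : Convex ℝ X)
    (hXU : X ⊆ U) (hG : Measurable fun p : U × S => G p.1 p.2)
    {x₀ σ : Ω → EuclideanSpace ℝ (Fin d)} (hx₀ : Measurable x₀) (hx₀X : ∀ ω, x₀ ω ∈ X)
    (hσ : Measurable σ) (m Λ : ℝ) {η : ℕ → Ω → S} {t : ℕ} (hη : ∀ k < t, Measurable (η k)) :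
    Measurable fun ω =>
      pssmIter X (x₀ ω) m (fun x s => G x s + (Λ • x - σ ω)) (fun k => η k ω) t := by
  induction t with
  | zero => exact hx₀
  | succ t ih =>
    have h := ih fun k hk => hη k (by omega)
    have h2 := measurable_oracle_comp hXU hG h
      (fun ω => pssmIter_mem hne hc hconv (hx₀X ω) m _ t) (hη t (by omega))
    exact (lipschitzWith_nearestPoint hne hc hconv).continuous.measurable.comp
      (h.sub ((h2.add ((h.const_smul Λ).sub hσ)).const_smul (2 / (m * ((t : ℝ) + 1)))))

theorem measurable_pssm (hne : X.Nonempty) (hc : IsClosed X) (hconv : Convex ℝ X)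
    (hXU : X ⊆ U) (hG : Measurable fun p : U × S => G p.1 p.2)
    {x₀ σ : Ω → EuclideanSpace ℝ (Fin d)} (hx₀ : Measurable x₀) (hx₀X : ∀ ω, x₀ ω ∈ X)
    (hσ : Measurable σ) (m Λ : ℝ) {η : ℕ → Ω → S} {T : ℕ} (hη : ∀ k < T, Measurable (η k)) :
    Measurable fun ω =>
      pssm X (x₀ ω) m (fun x s => G x s + (Λ • x - σ ω)) T (fun k => η k ω) := by
  unfold pssm
  refine Measurable.const_smul (Finset.measurable_fun_sum (Finset.range T) fun t ht => ?_)
    (2 / ((T : ℝ) * ((T : ℝ) + 1)))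
  exact (measurable_pssmIter hne hc hconv hXU hG hx₀ hx₀X hσ m Λ fun k hk =>
    hη k (hk.trans (Finset.mem_range.1 ht))).const_smul ((t : ℝ) + 1)

end Iterates

/-! ### Fresh samples and convergence in expectation. -/

section Expectation

variable {S : Type*} [MeasurableSpace S] {P : Measure S} [IsProbabilityMeasure P]
  {Ω : Type*} {𝓕 mΩ : MeasurableSpace Ω} {Q : Measure Ω} [IsProbabilityMeasure Q]

/-- Decoupling: a fresh sample may be replaced by an independent coordinate on `Ω × S`, so that
Fubini plays the role of conditional expectation. -/
theorem map_prodMk_eq_map_prod {𝓦 : Type*} [MeasurableSpace 𝓦] {W : Ω → 𝓦} {η : Ω → S}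
    (hW : Measurable W) (hη : Measurable η) (hlaw : Q.map η = P) (hind : IndepFun W η Q) :
    Q.map (fun ω => (W ω, η ω)) = (Q.prod P).map (fun p => (W p.1, p.2)) := by
  rw [(indepFun_iff_map_prod_eq_prod_map_map hW.aemeasurable hη.aemeasurable).1 hind, hlaw]
  have := Measure.map_prod_map Q P hW measurable_id
  rw [Measure.map_id] at this
  exact this

theorem integrable_comp_of_indepFun {𝓦 : Type*} [MeasurableSpace 𝓦] {W : Ω → 𝓦} {η : Ω → S}
    (hW : Measurable W) (hη : Measurable η) (hlaw : Q.map η = P) (hind : IndepFun W η Q)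
    {f : 𝓦 × S → ℝ} (hf : Measurable f) (hint : Integrable (fun p => f (W p.1, p.2)) (Q.prod P)) :
    Integrable (fun ω => f (W ω, η ω)) Q ∧
      ∫ ω, f (W ω, η ω) ∂Q = ∫ ω, ∫ s, f (W ω, s) ∂P ∂Q := by
  have hmap := map_prodMk_eq_map_prod hW hη hlaw hind
  have hm1 : Measurable fun ω => (W ω, η ω) := hW.prodMk hη
  have hm2 : Measurable fun p : Ω × S => (W p.1, p.2) :=
    (hW.comp measurable_fst).prodMk measurable_snd
  constructor
  · have h := (integrable_map_measure hf.aestronglyMeasurable hm2.aemeasurable).2 hint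
    rw [← hmap] at h
    exact (integrable_map_measure hf.aestronglyMeasurable hm1.aemeasurable).1 h
  · rw [← integral_prod _ hint, ← integral_map hm1.aemeasurable hf.aestronglyMeasurable, hmap,
      integral_map hm2.aemeasurable hf.aestronglyMeasurable]

variable {d : ℕ} {X U : Set (EuclideanSpace ℝ (Fin d))} {g : EuclideanSpace ℝ (Fin d) → ℝ}
  {G : EuclideanSpace ℝ (Fin d) → S → EuclideanSpace ℝ (Fin d)} {L : ℝ}

theorem integrable_comp_subtype_of_indep {A : Set (EuclideanSpace ℝ (Fin d))} (h𝓕 : 𝓕 ≤ mΩ)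
    {Y : Ω → EuclideanSpace ℝ (Fin d)} (hY : Measurable[𝓕] Y) (hYA : ∀ ω, Y ω ∈ A)
    {η : Ω → S} (hη : Measurable η) (hlaw : Q.map η = P)
    (hind : Indep 𝓕 (MeasurableSpace.comap η inferInstance) Q)
    {f : EuclideanSpace ℝ (Fin d) → S → ℝ} (hf : Measurable fun p : A × S => f p.1 p.2)
    (hint : Integrable (fun p : Ω × S => f (Y p.1) p.2) (Q.prod P)) :
    Integrable (fun ω => f (Y ω) (η ω)) Q ∧
      ∫ ω, f (Y ω) (η ω) ∂Q = ∫ ω, ∫ s, f (Y ω) s ∂P ∂Q := by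
  have hW𝓕 : Measurable[𝓕] fun ω => (⟨Y ω, hYA ω⟩ : A) := hY.subtype_mk
  exact integrable_comp_of_indepFun (hW𝓕.mono h𝓕 le_rfl) hη hlaw
    ((IndepFun_iff_Indep _ _ _).2 (indep_of_indep_of_le_left hind hW𝓕.comap_le)) hf hint

theorem IsStochasticOracle.expectation_sq (hG : IsStochasticOracle P X U g G L)
    (h𝓕 : 𝓕 ≤ mΩ) {Y : Ω → EuclideanSpace ℝ (Fin d)} (hY : Measurable[𝓕] Y) (hYX : ∀ ω, Y ω ∈ X)
    {η : Ω → S} (hη : Measurable η) (hlaw : Q.map η = P)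
    (hind : Indep 𝓕 (MeasurableSpace.comap η inferInstance) Q) :
    Integrable (fun ω => ‖G (Y ω) (η ω)‖ ^ 2) Q ∧ ∫ ω, ‖G (Y ω) (η ω)‖ ^ 2 ∂Q ≤ L ^ 2 ∧
      Integrable (fun p : Ω × S => ‖G (Y p.1) p.2‖ ^ 2) (Q.prod P) := by
  have hfm : Measurable fun p : Ω × S => ‖G (Y p.1) p.2‖ ^ 2 :=
    (measurable_oracle_comp hG.subset hG.measurable ((hY.mono h𝓕 le_rfl).comp measurable_fst)
      (fun p => hYX p.1) measurable_snd).norm.pow_const 2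
  have hbd : ∀ ω, ∫ s, ‖G (Y ω) s‖ ^ 2 ∂P ≤ L ^ 2 := fun ω => hG.second_moment _ (hYX ω)
  have hIm : Integrable (fun ω => ∫ s, ‖G (Y ω) s‖ ^ 2 ∂P) Q := by
    refine Integrable.of_bound
      (hfm.stronglyMeasurable.integral_prod_right').aestronglyMeasurable (L ^ 2)
      (Filter.Eventually.of_forall fun ω => ?_)
    rw [Real.norm_of_nonneg (integral_nonneg fun s => sq_nonneg _)]
    exact hbd ω
  have hint : Integrable (fun p : Ω × S => ‖G (Y p.1) p.2‖ ^ 2) (Q.prod P) := by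
    have hfib : ∀ ω, Integrable (fun s => ‖G (Y ω) s‖ ^ 2) P :=
      fun ω => hG.sq_integrable _ (hYX ω)
    refine (integrable_prod_iff hfm.aestronglyMeasurable).2
      ⟨Filter.Eventually.of_forall hfib, ?_⟩
    simpa only [norm_pow, norm_norm] using hIm
  obtain ⟨h1, h2⟩ := integrable_comp_subtype_of_indep h𝓕 hY (fun ω => hG.subset (hYX ω)) hη hlaw
    hind (f := fun x s => ‖G x s‖ ^ 2) (hG.measurable.norm.pow_const 2) hint
  refine ⟨h1, ?_, hint⟩
  calc ∫ ω, ‖G (Y ω) (η ω)‖ ^ 2 ∂Q = ∫ ω, ∫ s, ‖G (Y ω) s‖ ^ 2 ∂P ∂Q := h2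
    _ ≤ ∫ _, L ^ 2 ∂Q := integral_mono hIm (integrable_const _) hbd
    _ = L ^ 2 := by simp

/-- Given the past, the oracle may be replaced by its mean. `Z` is kept general because the
reference point will be a random minimizer. -/
theorem IsStochasticOracle.expectation_inner (hG : IsStochasticOracle P X U g G L)
    (h𝓕 : 𝓕 ≤ mΩ) {Y Z : Ω → EuclideanSpace ℝ (Fin d)}
    (hY : Measurable[𝓕] Y) (hYX : ∀ ω, Y ω ∈ X) (hZ : Measurable[𝓕] Z)
    (hYZ : Integrable (fun ω => ‖Y ω - Z ω‖ ^ 2) Q)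
    {η : Ω → S} (hη : Measurable η) (hlaw : Q.map η = P)
    (hind : Indep 𝓕 (MeasurableSpace.comap η inferInstance) Q) :
    Integrable (fun ω => inner ℝ (G (Y ω) (η ω)) (Y ω - Z ω)) Q ∧
      Integrable (fun ω => inner ℝ (∫ s, G (Y ω) s ∂P) (Y ω - Z ω)) Q ∧
      ∫ ω, inner ℝ (G (Y ω) (η ω)) (Y ω - Z ω) ∂Q
        = ∫ ω, inner ℝ (∫ s, G (Y ω) s ∂P) (Y ω - Z ω) ∂Q := by
  let W : Ω → U × EuclideanSpace ℝ (Fin d) := fun ω => (⟨Y ω, hG.subset (hYX ω)⟩, Z ω)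
  have hW𝓕 : Measurable[𝓕] W := (hY.subtype_mk).prodMk hZ
  have hW : Measurable W := hW𝓕.mono h𝓕 le_rfl
  have hWind : IndepFun W η Q :=
    (IndepFun_iff_Indep _ _ _).2 (indep_of_indep_of_le_left hind hW𝓕.comap_le)
  have hf : Measurable fun p : (U × EuclideanSpace ℝ (Fin d)) × S =>
      (inner ℝ (G p.1.1 p.2) ((p.1.1 : EuclideanSpace ℝ (Fin d)) - p.1.2) : ℝ) := by
    refine Measurable.inner ?_ ?_
    · exact hG.measurable.comp ((measurable_fst.comp measurable_fst).prodMk measurable_snd)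
    · exact (measurable_subtype_coe.comp (measurable_fst.comp measurable_fst)).sub
        (measurable_snd.comp measurable_fst)
  have hm2 : Measurable fun p : Ω × S => (W p.1, p.2) :=
    (hW.comp measurable_fst).prodMk measurable_snd
  obtain ⟨-, -, hsq⟩ := hG.expectation_sq h𝓕 hY hYX hη hlaw hind
  have hint : Integrable (fun p : Ω × S => (inner ℝ (G (Y p.1) p.2) (Y p.1 - Z p.1) : ℝ))
      (Q.prod P) := by
    refine Integrable.mono' (hsq.add (hYZ.comp_fst P)) (hf.comp hm2).aestronglyMeasurable
      (Filter.Eventually.of_forall fun p => ?_)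
    have := abs_real_inner_le_norm (G (Y p.1) p.2) (Y p.1 - Z p.1)
    simp only [Real.norm_eq_abs, Pi.add_apply]
    nlinarith [sq_nonneg (‖G (Y p.1) p.2‖ - ‖Y p.1 - Z p.1‖), sq_nonneg ‖G (Y p.1) p.2‖,
      sq_nonneg ‖Y p.1 - Z p.1‖]
  obtain ⟨h1, h2⟩ := integrable_comp_of_indepFun hW hη hlaw hWind hf hint
  have h3 : ∀ ω, ∫ s, inner ℝ (G (Y ω) s) (Y ω - Z ω) ∂P
      = inner ℝ (∫ s, G (Y ω) s ∂P) (Y ω - Z ω) := fun ω => by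
    simp only [real_inner_comm (Y ω - Z ω)]
    exact integral_inner (hG.integrable _ (hG.subset (hYX ω))) _
  have h4 := hint.integral_prod_left
  simp only [h3] at h4
  refine ⟨h1, h4, ?_⟩
  calc ∫ ω, inner ℝ (G (Y ω) (η ω)) (Y ω - Z ω) ∂Q
      = ∫ ω, ∫ s, inner ℝ (G (Y ω) s) (Y ω - Z ω) ∂P ∂Q := h2
    _ = _ := by simp only [h3]

theorem integrable_norm_sub_sq (hXb : Bornology.IsBounded X)
    {Y Z : Ω → EuclideanSpace ℝ (Fin d)} (hY : Measurable Y) (hZ : Measurable Z)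
    (hYX : ∀ ω, Y ω ∈ X) (hZX : ∀ ω, Z ω ∈ X) :
    Integrable (fun ω => ‖Y ω - Z ω‖ ^ 2) Q := by
  refine Integrable.of_bound ((hY.sub hZ).norm.pow_const 2).aestronglyMeasurable
    (Metric.diam X ^ 2) (Filter.Eventually.of_forall fun ω => ?_)
  rw [Real.norm_of_nonneg (sq_nonneg _), ← dist_eq_norm]
  exact pow_le_pow_left₀ dist_nonneg (Metric.dist_le_diam_of_mem hXb (hYX ω) (hZX ω)) 2

/-- One projected stochastic subgradient step. -/
theorem IsStochasticOracle.expectation_step (hG : IsStochasticOracle P X U g G L)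
    (hne : X.Nonempty) (hc : IsClosed X) (hconv : Convex ℝ X) (hXb : Bornology.IsBounded X)
    (h𝓕 : 𝓕 ≤ mΩ) {Y V Z : Ω → EuclideanSpace ℝ (Fin d)}
    (hY : Measurable[𝓕] Y) (hYX : ∀ ω, Y ω ∈ X) (hV : Measurable[𝓕] V)
    (hZ : Measurable[𝓕] Z) (hZX : ∀ ω, Z ω ∈ X)
    {η : Ω → S} (hη : Measurable η) (hlaw : Q.map η = P)
    (hind : Indep 𝓕 (MeasurableSpace.comap η inferInstance) Q)
    {R m γ : ℝ} (hR : ∀ ω, ‖V ω‖ ≤ R) (hγ : 0 ≤ γ)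
    (hmono : ∀ ω, ∀ v ∈ subdifferential g (Y ω),
      m * ‖Y ω - Z ω‖ ^ 2 ≤ inner ℝ (v + V ω) (Y ω - Z ω)) :
    ∫ ω, ‖nearestPoint X (Y ω - γ • (G (Y ω) (η ω) + V ω)) - Z ω‖ ^ 2 ∂Q
      ≤ (1 - 2 * γ * m) * ∫ ω, ‖Y ω - Z ω‖ ^ 2 ∂Q + γ ^ 2 * (2 * (L ^ 2 + R ^ 2)) := by
  have hY' := hY.mono h𝓕 le_rfl
  have hV' := hV.mono h𝓕 le_rfl
  have hZ' := hZ.mono h𝓕 le_rfl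
  have hi1 := integrable_norm_sub_sq (Q := Q) hXb hY' hZ' hYX hZX
  obtain ⟨hi2, hI2, -⟩ := hG.expectation_sq h𝓕 hY hYX hη hlaw hind
  obtain ⟨hi3, hi4, hI3⟩ := hG.expectation_inner h𝓕 hY hYX hZ hi1 hη hlaw hind
  have hi5 : Integrable (fun ω => (inner ℝ (V ω) (Y ω - Z ω) : ℝ)) Q := by
    refine Integrable.mono' ((integrable_const (R ^ 2)).add hi1)
      (hV'.inner (hY'.sub hZ')).aestronglyMeasurable (Filter.Eventually.of_forall fun ω => ?_)
    have := abs_real_inner_le_norm (V ω) (Y ω - Z ω)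
    simp only [Real.norm_eq_abs, Pi.add_apply]
    nlinarith [sq_nonneg (‖V ω‖ - ‖Y ω - Z ω‖), sq_nonneg ‖Y ω - Z ω‖,
      pow_le_pow_left₀ (norm_nonneg _) (hR ω) 2, sq_nonneg ‖V ω‖]
  have hGm := measurable_oracle_comp hG.subset hG.measurable hY' hYX hη
  have hi6 : Integrable
      (fun ω => ‖nearestPoint X (Y ω - γ • (G (Y ω) (η ω) + V ω)) - Z ω‖ ^ 2) Q :=
    integrable_norm_sub_sq hXb
      ((lipschitzWith_nearestPoint hne hc hconv).continuous.measurable.comp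
        (hY'.sub ((hGm.add hV').const_smul γ))) hZ'
      (fun ω => nearestPoint_mem hne hc hconv _) hZX
  -- Projection does not increase the distance to `Z ω ∈ X`; the square is then expanded.
  have hpt : ∀ ω, ‖nearestPoint X (Y ω - γ • (G (Y ω) (η ω) + V ω)) - Z ω‖ ^ 2
      ≤ ‖Y ω - Z ω‖ ^ 2 - 2 * γ * (inner ℝ (G (Y ω) (η ω)) (Y ω - Z ω)
          + inner ℝ (V ω) (Y ω - Z ω)) + γ ^ 2 * 2 * (‖G (Y ω) (η ω)‖ ^ 2 + R ^ 2) := by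
    intro ω
    have h1 := norm_nearestPoint_sub_le hne hc hconv
      (Y ω - γ • (G (Y ω) (η ω) + V ω)) (hZX ω)
    have h2 := pow_le_pow_left₀ (norm_nonneg _) h1 2
    have e : ‖Y ω - γ • (G (Y ω) (η ω) + V ω) - Z ω‖ ^ 2 = ‖Y ω - Z ω‖ ^ 2
        - 2 * γ * (inner ℝ (G (Y ω) (η ω)) (Y ω - Z ω) + inner ℝ (V ω) (Y ω - Z ω))
        + γ ^ 2 * ‖G (Y ω) (η ω) + V ω‖ ^ 2 := by
      rw [sub_right_comm, norm_sub_sq_real, real_inner_smul_right, real_inner_comm,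
        inner_add_left, norm_smul, mul_pow, Real.norm_eq_abs, sq_abs]
      ring
    have h3 : ‖G (Y ω) (η ω) + V ω‖ ^ 2 ≤ 2 * (‖G (Y ω) (η ω)‖ ^ 2 + R ^ 2) := by
      have h4 := pow_le_pow_left₀ (norm_nonneg _) (norm_add_le (G (Y ω) (η ω)) (V ω)) 2
      have h5 := pow_le_pow_left₀ (norm_nonneg _) (hR ω) 2
      nlinarith [sq_nonneg (‖G (Y ω) (η ω)‖ - ‖V ω‖)]
    nlinarith [mul_le_mul_of_nonneg_left h3 (sq_nonneg γ)]
  have hi7 : Integrable (fun ω => inner ℝ (G (Y ω) (η ω)) (Y ω - Z ω)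
      + inner ℝ (V ω) (Y ω - Z ω)) Q := hi3.add hi5
  have hi8 : Integrable (fun ω => ‖Y ω - Z ω‖ ^ 2 - 2 * γ * (inner ℝ (G (Y ω) (η ω)) (Y ω - Z ω)
      + inner ℝ (V ω) (Y ω - Z ω))) Q := hi1.sub (hi7.const_mul (2 * γ))
  have hi9 : Integrable (fun ω => ‖G (Y ω) (η ω)‖ ^ 2 + R ^ 2) Q := hi2.add (integrable_const _)
  have hI := integral_mono hi6 (hi8.add (hi9.const_mul (γ ^ 2 * 2))) hpt
  have hE : ∫ ω, (‖Y ω - Z ω‖ ^ 2 - 2 * γ * (inner ℝ (G (Y ω) (η ω)) (Y ω - Z ω)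
          + inner ℝ (V ω) (Y ω - Z ω)) + γ ^ 2 * 2 * (‖G (Y ω) (η ω)‖ ^ 2 + R ^ 2)) ∂Q
      = ∫ ω, ‖Y ω - Z ω‖ ^ 2 ∂Q - 2 * γ * (∫ ω, inner ℝ (G (Y ω) (η ω)) (Y ω - Z ω) ∂Q
          + ∫ ω, inner ℝ (V ω) (Y ω - Z ω) ∂Q)
        + γ ^ 2 * 2 * (∫ ω, ‖G (Y ω) (η ω)‖ ^ 2 ∂Q + R ^ 2) := by
    rw [integral_add hi8 (hi9.const_mul (γ ^ 2 * 2)), integral_sub hi1 (hi7.const_mul (2 * γ)),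
      integral_const_mul, integral_const_mul, integral_add hi3 hi5,
      integral_add hi2 (integrable_const _)]
    simp
  -- The averaged oracle is a true subgradient, so `hmono` applies pointwise.
  have hM : m * ∫ ω, ‖Y ω - Z ω‖ ^ 2 ∂Q ≤ ∫ ω, inner ℝ (G (Y ω) (η ω)) (Y ω - Z ω) ∂Q
      + ∫ ω, inner ℝ (V ω) (Y ω - Z ω) ∂Q := by
    rw [hI3, ← integral_add hi4 hi5, ← integral_const_mul]
    refine integral_mono (hi1.const_mul m) (hi4.add hi5) fun ω => ?_
    have := hmono ω _ (hG.mean_mem _ (hG.subset (hYX ω)))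
    rwa [inner_add_left] at this
  refine hI.trans (hE.trans_le ?_)
  nlinarith [mul_le_mul_of_nonneg_left hM hγ, mul_le_mul_of_nonneg_left hI2 (sq_nonneg γ)]

/-- Multiplying the recursion by `(t+1)²/4` makes it telescope with potential `t²/4 * a t`. Each
step leaves `(t+1) - (t+1)²/4 + t²/4 = (t+1)/2 + 1/4` as coefficient of `a t`, at least half the
desired weight. -/
theorem sum_weighted_le_of_recursion {a : ℕ → ℝ} (ha : ∀ t, 0 ≤ a t) {C : ℝ}
    (h : ∀ t : ℕ, a (t + 1) ≤ (1 - 4 / ((t : ℝ) + 1)) * a t + 4 / ((t : ℝ) + 1) ^ 2 * C) (n : ℕ) :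
    ∑ t ∈ Finset.range n, ((t : ℝ) + 1) * a t ≤ 2 * n * C := by
  have key : ∑ t ∈ Finset.range n, (((t : ℝ) + 1) / 2 + 1 / 4) * a t + (n : ℝ) ^ 2 / 4 * a n
      ≤ n * C := by
    induction n with
    | zero => simp
    | succ n ih =>
      rw [Finset.sum_range_succ]
      have h1 := mul_le_mul_of_nonneg_left (h n) (by positivity : (0 : ℝ) ≤ ((n : ℝ) + 1) ^ 2 / 4)
      have e : ((n : ℝ) + 1) ^ 2 / 4
          * ((1 - 4 / ((n : ℝ) + 1)) * a n + 4 / ((n : ℝ) + 1) ^ 2 * C)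
          = (((n : ℝ) + 1) ^ 2 / 4 - (n + 1)) * a n + C := by
        field_simp
      push_cast
      linarith
  have h2 : ∑ t ∈ Finset.range n, ((t : ℝ) + 1) * a t
      ≤ 2 * ∑ t ∈ Finset.range n, (((t : ℝ) + 1) / 2 + 1 / 4) * a t := by
    rw [Finset.mul_sum]
    refine Finset.sum_le_sum fun t _ => ?_
    nlinarith [ha t]
  nlinarith [mul_nonneg (by positivity : (0 : ℝ) ≤ (n : ℝ) ^ 2 / 4) (ha n)]

/-- Jensen for the square, from `2cf ≤ f² + c²`. -/
theorem integral_le_of_integral_sq_le {f : Ω → ℝ} {c : ℝ} (hc : 0 < c)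
    (hf2 : Integrable (fun ω => f ω ^ 2) Q) (hf : Integrable f Q) (h : ∫ ω, f ω ^ 2 ∂Q ≤ c ^ 2) :
    ∫ ω, f ω ∂Q ≤ c := by
  have h1 : ∫ ω, f ω * (2 * c) ∂Q ≤ ∫ ω, (f ω ^ 2 + c ^ 2) ∂Q :=
    integral_mono (hf.mul_const _) (hf2.add (integrable_const _)) fun ω => by
      change f ω * (2 * c) ≤ f ω ^ 2 + c ^ 2
      nlinarith [sq_nonneg (f ω - c)]
  rw [integral_mul_const, integral_add hf2 (integrable_const _)] at h1
  simp only [integral_const, probReal_univ, one_smul] at h1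
  nlinarith

/-- Convergence of the projected stochastic subgradient method on the regularized problem. -/
theorem IsStochasticOracle.expectation_pssm (hG : IsStochasticOracle P X U g G L)
    (hne : X.Nonempty) (hc : IsClosed X) (hconv : Convex ℝ X) (hXb : Bornology.IsBounded X)
    (hgc : Continuous g) {μ Λ R B : ℝ} (hg : StrongConvexOn X μ g) (hm : 0 < μ + Λ)
    {𝓕 : ℕ → MeasurableSpace Ω} (h𝓕 : ∀ t, 𝓕 t ≤ mΩ) {x₀ σ : Ω → EuclideanSpace ℝ (Fin d)}
    (hx₀ : ∀ t, Measurable[𝓕 t] x₀) (hx₀X : ∀ ω, x₀ ω ∈ X) (hσ : ∀ t, Measurable[𝓕 t] σ)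
    {η : ℕ → Ω → S} (hη𝓕 : ∀ t, ∀ k < t, Measurable[𝓕 t] (η k)) (hη : ∀ t, Measurable (η t))
    (hlaw : ∀ t, Q.map (η t) = P)
    (hind : ∀ t, Indep (𝓕 t) (MeasurableSpace.comap (η t) inferInstance) Q)
    (hR : ∀ ω, ∀ x ∈ X, ‖Λ • x - σ ω‖ ≤ R) (hB : 0 < B) (hRB : 2 * (L ^ 2 + R ^ 2) ≤ B ^ 2)
    {T : ℕ} (hT : 1 ≤ T) :
    Integrable (fun ω => ‖pssm X (x₀ ω) (μ + Λ) (fun x s => G x s + (Λ • x - σ ω)) T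
      (fun k => η k ω) - proxPoint X g μ Λ (σ ω)‖) Q ∧
    ∫ ω, ‖pssm X (x₀ ω) (μ + Λ) (fun x s => G x s + (Λ • x - σ ω)) T
      (fun k => η k ω) - proxPoint X g μ Λ (σ ω)‖ ∂Q ≤ 2 * B / ((μ + Λ) * √((T : ℝ) + 1)) := by
  have hXc : IsCompact X := Metric.isCompact_of_isClosed_isBounded hc hXb
  set Z : Ω → EuclideanSpace ℝ (Fin d) := fun ω => proxPoint X g μ Λ (σ ω) with hZ
  have hprox : ∀ ω, IsProxPoint X g μ Λ (σ ω) (Z ω) :=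
    fun ω => isProxPoint_proxPoint hne hXc hgc hg _
  set Y : ℕ → Ω → EuclideanSpace ℝ (Fin d) := fun t ω =>
    pssmIter X (x₀ ω) (μ + Λ) (fun x s => G x s + (Λ • x - σ ω)) (fun k => η k ω) t with hYdef
  have hYX : ∀ t ω, Y t ω ∈ X := fun t ω => pssmIter_mem hne hc hconv (hx₀X ω) _ _ t
  have hY𝓕 : ∀ t, Measurable[𝓕 t] (Y t) := fun t =>
    @measurable_pssmIter d S X U G _ Ω (𝓕 t) hne hc hconv hG.subset hG.measurable x₀ σ (hx₀ t)
      hx₀X (hσ t) (μ + Λ) Λ η t (hη𝓕 t)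
  have hZ𝓕 : ∀ t, Measurable[𝓕 t] Z := fun t =>
    (continuous_proxPoint hne hXc hgc hg hm).measurable.comp (hσ t)
  have hYm : ∀ t, Measurable (Y t) := fun t => (hY𝓕 t).mono (h𝓕 t) le_rfl
  have hZm : Measurable Z := (hZ𝓕 0).mono (h𝓕 0) le_rfl
  set a : ℕ → ℝ := fun t => ∫ ω, ‖Y t ω - Z ω‖ ^ 2 ∂Q with ha
  have hrec : ∀ t : ℕ, a (t + 1) ≤ (1 - 4 / ((t : ℝ) + 1)) * a t
      + 4 / ((t : ℝ) + 1) ^ 2 * (B ^ 2 / (μ + Λ) ^ 2) := by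
    intro t
    -- The penalty gradient `Λ • Y t - σ` is the past-measurable shift `V`.
    have h := hG.expectation_step hne hc hconv hXb (h𝓕 t) (hY𝓕 t) (hYX t)
      (((hY𝓕 t).const_smul Λ).sub (hσ t)) (hZ𝓕 t) (fun ω => (hprox ω).1) (hη t) (hlaw t)
      (hind t) (R := R) (m := μ + Λ) (γ := 2 / ((μ + Λ) * ((t : ℝ) + 1)))
      (fun ω => hR ω _ (hYX t ω)) (by positivity)
      (fun ω v hv => (hprox ω).inner_subgradient_ge hg (hYX t ω) hv)
    refine h.trans ?_
    have e1 : 2 * (2 / ((μ + Λ) * ((t : ℝ) + 1))) * (μ + Λ) = 4 / ((t : ℝ) + 1) := by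
      field_simp
      norm_num
    have e2 : (2 / ((μ + Λ) * ((t : ℝ) + 1))) ^ 2 * B ^ 2
        = 4 / ((t : ℝ) + 1) ^ 2 * (B ^ 2 / (μ + Λ) ^ 2) := by
      field_simp
      norm_num
    rw [e1, ← e2]
    gcongr
  have hsum := sum_weighted_le_of_recursion (a := a) (fun t => integral_nonneg fun ω => sq_nonneg _) hrec T
  have hpm : Measurable fun ω =>
      pssm X (x₀ ω) (μ + Λ) (fun x s => G x s + (Λ • x - σ ω)) T (fun k => η k ω) :=
    measurable_pssm hne hc hconv hG.subset hG.measurable ((hx₀ 0).mono (h𝓕 0) le_rfl) hx₀X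
      ((hσ 0).mono (h𝓕 0) le_rfl) _ _ fun k _ => hη k
  have hpX := fun ω => pssm_mem (G := fun x s => G x s + (Λ • x - σ ω)) hne hc hconv (hx₀X ω)
    (μ + Λ) hT (fun k => η k ω)
  have hi2 := integrable_norm_sub_sq (Q := Q) hXb hpm hZm hpX fun ω => (hprox ω).1
  have hi : Integrable (fun ω => ‖pssm X (x₀ ω) (μ + Λ) (fun x s => G x s + (Λ • x - σ ω)) T
      (fun k => η k ω) - Z ω‖) Q := by
    refine Integrable.of_bound (hpm.sub hZm).norm.aestronglyMeasurable
      (Metric.diam X) (Filter.Eventually.of_forall fun ω => ?_)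
    rw [norm_norm, ← dist_eq_norm]
    exact Metric.dist_le_diam_of_mem hXb (hpX ω) (hprox ω).1
  refine ⟨hi, integral_le_of_integral_sq_le (by positivity) hi2 hi ?_⟩
  have hT0 : (0 : ℝ) < T := by exact_mod_cast hT
  have hiY : ∀ t, Integrable (fun ω => ‖Y t ω - Z ω‖ ^ 2) Q := fun t =>
    integrable_norm_sub_sq hXb (hYm t) hZm (hYX t) fun ω => (hprox ω).1
  calc _ ≤ ∫ ω, ∑ t ∈ Finset.range T,
        2 / ((T : ℝ) * ((T : ℝ) + 1)) * ((t : ℝ) + 1) * ‖Y t ω - Z ω‖ ^ 2 ∂Q :=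
        integral_mono hi2 (integrable_finsetSum _ fun t _ => (hiY t).const_mul _)
          fun ω => norm_pssm_sub_sq_le _ _ hT _ _
    _ = 2 / ((T : ℝ) * ((T : ℝ) + 1)) * ∑ t ∈ Finset.range T, ((t : ℝ) + 1) * a t := by
        rw [integral_finsetSum _ fun t _ => (hiY t).const_mul _, Finset.mul_sum]
        refine Finset.sum_congr rfl fun t _ => ?_
        rw [integral_const_mul, mul_assoc]
    _ ≤ 2 / ((T : ℝ) * ((T : ℝ) + 1)) * (2 * T * (B ^ 2 / (μ + Λ) ^ 2)) := by gcongr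
    _ = _ := by
        rw [div_pow, mul_pow, mul_pow, Real.sq_sqrt (by positivity)]
        field_simp

end Expectation

/-! ### Stages of gradual regularization. -/

section GradualRegularization

variable {d : ℕ} {S : Type*} {X U : Set (EuclideanSpace ℝ (Fin d))}
  {G : EuclideanSpace ℝ (Fin d) → S → EuclideanSpace ℝ (Fin d)}

theorem penalty_pos {μ : ℝ} (hμ : 0 < μ) (i : ℕ) : 0 < penalty μ i := by
  unfold penalty
  positivity

theorem sum_range_penalty (μ : ℝ) (i : ℕ) :
    ∑ j ∈ Finset.range (i + 1), penalty μ j = μ + ∑ j ∈ Finset.Icc 1 i, penalty μ j := by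
  induction i with
  | zero => simp [penalty]
  | succ i ih => rw [Finset.sum_range_succ, ih, Finset.sum_Icc_succ_top (by omega), add_assoc]

theorem sum_Icc_penalty (μ : ℝ) (i : ℕ) :
    ∑ j ∈ Finset.Icc 1 i, penalty μ j = 2 * μ * (2 ^ i - 1) := by
  induction i with
  | zero => simp
  | succ i ih => rw [Finset.sum_Icc_succ_top (by omega), ih, penalty]; ring

/-- The weighted sum of the centers penalized in stage `i`. -/
def penaltySum (X : Set (EuclideanSpace ℝ (Fin d))) (x₁ : EuclideanSpace ℝ (Fin d)) (μ : ℝ)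
    (T : ℕ) (G : EuclideanSpace ℝ (Fin d) → S → EuclideanSpace ℝ (Fin d)) (ξ : ℕ → ℕ → S)
    (i : ℕ) : EuclideanSpace ℝ (Fin d) :=
  ∑ j ∈ Finset.Icc 1 i, penalty μ j • grCenter X x₁ μ T G ξ j

/-- Unrolls the recursive oracle: all penalty gradients merge into one affine shift, so a single
analysis of the method covers every stage. -/
theorem grState_snd (x₁ : EuclideanSpace ℝ (Fin d)) (μ : ℝ) (T : ℕ) (ξ : ℕ → ℕ → S) (i : ℕ) :
    (grState X x₁ μ T G ξ i).2 = fun x s => G x s +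
      ((∑ j ∈ Finset.Icc 1 i, penalty μ j) • x - penaltySum X x₁ μ T G ξ i) := by
  induction i with
  | zero => simp [grState, penaltySum]
  | succ i ih =>
    have h : (grState X x₁ μ T G ξ (i + 1)).2 = fun x s => (grState X x₁ μ T G ξ i).2 x s
        + penalty μ (i + 1) • (x - grCenter X x₁ μ T G ξ (i + 1)) := rfl
    rw [h, ih]
    funext x s
    rw [penaltySum, penaltySum, Finset.sum_Icc_succ_top (by omega),
      Finset.sum_Icc_succ_top (by omega)]
    module

theorem grCenter_succ (x₁ : EuclideanSpace ℝ (Fin d)) (μ : ℝ) (T : ℕ) (ξ : ℕ → ℕ → S) (i : ℕ) :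
    grCenter X x₁ μ T G ξ (i + 1) = pssm X (grCenter X x₁ μ T G ξ i)
      (μ + ∑ j ∈ Finset.Icc 1 i, penalty μ j) (fun x s => G x s +
        ((∑ j ∈ Finset.Icc 1 i, penalty μ j) • x - penaltySum X x₁ μ T G ξ i)) T (ξ i) := by
  rw [← sum_range_penalty, ← grState_snd]
  rfl

theorem grCenter_mem (hne : X.Nonempty) (hc : IsClosed X) (hconv : Convex ℝ X)
    {x₁ : EuclideanSpace ℝ (Fin d)} (hx₁ : x₁ ∈ X) (μ : ℝ) {T : ℕ} (hT : 1 ≤ T)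
    (ξ : ℕ → ℕ → S) (i : ℕ) : grCenter X x₁ μ T G ξ i ∈ X := by
  induction i with
  | zero => exact hx₁
  | succ i ih =>
    rw [grCenter_succ]
    exact pssm_mem hne hc hconv ih _ hT _

theorem norm_sum_penalty_smul_sub_le (hXb : Bornology.IsBounded X) {D : ℝ}
    (hD : Metric.diam X ≤ D) {μ : ℝ} (hμ : 0 < μ) (i : ℕ) {a : ℕ → EuclideanSpace ℝ (Fin d)}
    (ha : ∀ i, a i ∈ X) {x : EuclideanSpace ℝ (Fin d)} (hx : x ∈ X) :
    ‖(∑ j ∈ Finset.Icc 1 i, penalty μ j) • x - ∑ j ∈ Finset.Icc 1 i, penalty μ j • a j‖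
      ≤ (∑ j ∈ Finset.Icc 1 i, penalty μ j) * D := by
  rw [Finset.sum_smul, ← Finset.sum_sub_distrib, Finset.sum_mul]
  refine norm_sum_le_of_le _ fun j _ => ?_
  rw [← smul_sub, norm_smul, Real.norm_of_nonneg (penalty_pos hμ j).le, ← dist_eq_norm]
  exact mul_le_mul_of_nonneg_left ((Metric.dist_le_diam_of_mem hXb hx (ha j)).trans hD)
    (penalty_pos hμ j).le

/-- Pathwise bound on the gradient of the envelope at the output, by the stage errors. -/
theorem norm_gradient_gradualReg_le (hc : IsClosed X) (hXb : Bornology.IsBounded X)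
    {g : EuclideanSpace ℝ (Fin d) → ℝ} (hgc : Continuous g) {μ lam : ℝ} (hμ : 0 < μ) (hlam : 0 < lam)
    (hg : StrongConvexOn X μ g) {x₁ : EuclideanSpace ℝ (Fin d)} (hx₁ : x₁ ∈ X) {T N : ℕ}
    (hN : ∑ j ∈ Finset.Icc 1 N, penalty μ j = lam) (ξ : ℕ → ℕ → S) :
    ‖gradient (fun x => (moreauEnvelope (extendTop X g) (1 / (2 * lam)) x).toReal)
        (gradualReg X x₁ μ lam T N G ξ)‖
      ≤ lam * ‖grCenter X x₁ μ T G ξ (N + 1) - proxPoint X g μ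
          (∑ j ∈ Finset.Icc 1 N, penalty μ j) (penaltySum X x₁ μ T G ξ N)‖
        + 2 * ∑ i ∈ Finset.range N, penalty μ (i + 1) *
          ‖grCenter X x₁ μ T G ξ (i + 1) - proxPoint X g μ
            (∑ j ∈ Finset.Icc 1 i, penalty μ j) (penaltySum X x₁ μ T G ξ i)‖ := by
  have hne : X.Nonempty := ⟨x₁, hx₁⟩
  have hXc : IsCompact X := Metric.isCompact_of_isClosed_isBounded hc hXb
  set p : ℕ → EuclideanSpace ℝ (Fin d) := fun i => proxPoint X g μ
    (∑ j ∈ Finset.Icc 1 i, penalty μ j) (penaltySum X x₁ μ T G ξ i) with hpdef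
  have hp : ∀ i, IsProxPoint X g μ (∑ j ∈ Finset.Icc 1 i, penalty μ j)
      (∑ j ∈ Finset.Icc 1 i, penalty μ j • grCenter X x₁ μ T G ξ j) (p i) :=
    fun i => isProxPoint_proxPoint hne hXc hgc hg _
  have hpN := hp N
  rw [hN] at hpN
  have h1 := norm_gradient_moreauEnvelope_midpoint_le hne hXc hgc hg hμ hlam
    (b := grCenter X x₁ μ T G ξ (N + 1)) hpN
  -- The penalties sum to `lam`, so the normalization is exactly the midpoint one.
  have hout : gradualReg X x₁ μ lam T N G ξ = (1 / (2 * lam)) •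
      (lam • grCenter X x₁ μ T G ξ (N + 1)
        + ∑ j ∈ Finset.Icc 1 N, penalty μ j • grCenter X x₁ μ T G ξ j) := by
    rw [gradualReg, hN, ← two_mul]
  rw [hout]
  refine h1.trans (add_le_add_right ?_ _)
  refine le_trans ?_ (sum_penalty_mul_norm_le hμ hp N)
  rw [← hN, Finset.sum_smul, ← Finset.sum_sub_distrib]
  refine norm_sum_le_of_le _ fun j _ => ?_
  rw [← smul_sub, norm_smul, Real.norm_of_nonneg (penalty_pos hμ j).le]

variable {Ω : Type*}

theorem measurable_penaltySum [MeasurableSpace Ω] {x₁ : EuclideanSpace ℝ (Fin d)} {μ : ℝ} {T : ℕ}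
    {ξ : ℕ → ℕ → Ω → S} {i : ℕ}
    (h : ∀ j ≤ i, Measurable fun ω => grCenter X x₁ μ T G (fun i t => ξ i t ω) j) :
    Measurable fun ω => penaltySum X x₁ μ T G (fun i t => ξ i t ω) i := by
  unfold penaltySum
  exact Finset.measurable_fun_sum _ fun j hj =>
    (h j (Finset.mem_Icc.1 hj).2).const_smul (penalty μ j)

variable [MeasurableSpace S]

theorem measurable_grCenter [MeasurableSpace Ω] (hne : X.Nonempty) (hc : IsClosed X)
    (hconv : Convex ℝ X) (hXU : X ⊆ U) (hG : Measurable fun p : U × S => G p.1 p.2)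
    {x₁ : EuclideanSpace ℝ (Fin d)} (hx₁ : x₁ ∈ X) (μ : ℝ) {T : ℕ} (hT : 1 ≤ T)
    {ξ : ℕ → ℕ → Ω → S} (i : ℕ) (hξ : ∀ j < i, ∀ t, Measurable (ξ j t)) :
    Measurable fun ω => grCenter X x₁ μ T G (fun i t => ξ i t ω) i := by
  induction i using Nat.strong_induction_on with
  | _ i ih =>
    cases i with
    | zero => exact measurable_const
    | succ i =>
      have hle : ∀ j ≤ i, Measurable fun ω => grCenter X x₁ μ T G (fun i t => ξ i t ω) j :=
        fun j hj => ih j (by omega) fun k hk => hξ k (by omega)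
      simp only [grCenter_succ]
      exact measurable_pssm hne hc hconv hXU hG (hle i le_rfl)
        (fun ω => grCenter_mem hne hc hconv hx₁ μ hT _ i) (measurable_penaltySum hle) _ _
        fun k _ => hξ i (by omega) k

/-- The σ-algebra of the samples used before step `t` of stage `i`. -/
@[reducible]
def sampleHistory (ξ : ℕ → ℕ → Ω → S) (i t : ℕ) : MeasurableSpace Ω :=
  ⨆ p ∈ {p : ℕ × ℕ | p.1 < i ∨ p.1 = i ∧ p.2 < t},
    MeasurableSpace.comap (ξ p.1 p.2) inferInstance

theorem measurable_sampleHistory (ξ : ℕ → ℕ → Ω → S) {i t j k : ℕ}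
    (h : j < i ∨ j = i ∧ k < t) : Measurable[sampleHistory ξ i t] (ξ j k) := by
  refine Measurable.of_comap_le ?_
  exact le_iSup₂_of_le (f := fun (p : ℕ × ℕ) (_ : p ∈ {p : ℕ × ℕ | p.1 < i ∨ p.1 = i ∧ p.2 < t}) =>
    MeasurableSpace.comap (ξ p.1 p.2) inferInstance) (j, k) h le_rfl

theorem sampleHistory_le {mΩ : MeasurableSpace Ω} {ξ : ℕ → ℕ → Ω → S}
    (hξ : ∀ i t, Measurable (ξ i t)) (i t : ℕ) : sampleHistory ξ i t ≤ mΩ :=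
  iSup₂_le fun p _ => (hξ p.1 p.2).comap_le

/-- The index `(i, t)` is not in its own strict lexicographic past. -/
theorem indep_sampleHistory {mΩ : MeasurableSpace Ω} {Q : Measure Ω} {ξ : ℕ → ℕ → Ω → S}
    (hξ : ∀ i t, Measurable (ξ i t)) (hind : iIndepFun (fun p : ℕ × ℕ => ξ p.1 p.2) Q)
    (i t : ℕ) :
    Indep (sampleHistory ξ i t) (MeasurableSpace.comap (ξ i t) inferInstance) Q := by
  have h := indep_iSup_of_disjoint (fun p : ℕ × ℕ => (hξ p.1 p.2).comap_le)
    hind.iIndep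
    (S := {p : ℕ × ℕ | p.1 < i ∨ p.1 = i ∧ p.2 < t}) (T := {(i, t)})
    (Set.disjoint_singleton_right.2 (by simp))
  simpa only [Set.mem_singleton_iff, iSup_iSup_eq_left] using h

variable {mΩ : MeasurableSpace Ω} {P : Measure S} [IsProbabilityMeasure P] {Q : Measure Ω}
  [IsProbabilityMeasure Q] {g : EuclideanSpace ℝ (Fin d) → ℝ} {L : ℝ}

/-- One stage of gradual regularization. -/
theorem IsStochasticOracle.expectation_stage (hG : IsStochasticOracle P X U g G L)
    (hc : IsClosed X) (hconv : Convex ℝ X) (hXb : Bornology.IsBounded X) {D : ℝ}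
    (hD : Metric.diam X ≤ D) (hgc : Continuous g) {μ : ℝ} (hμ : 0 < μ)
    (hg : StrongConvexOn X μ g) {ξ : ℕ → ℕ → Ω → S} (hξ : ∀ i t, Measurable (ξ i t))
    (hlaw : ∀ i t, Q.map (ξ i t) = P) (hind : iIndepFun (fun p : ℕ × ℕ => ξ p.1 p.2) Q)
    {x₁ : EuclideanSpace ℝ (Fin d)} (hx₁ : x₁ ∈ X) {T : ℕ} (hT : 1 ≤ T) (i : ℕ) {B : ℝ}
    (hB : 0 < B)
    (hRB : 2 * (L ^ 2 + ((∑ j ∈ Finset.Icc 1 i, penalty μ j) * D) ^ 2) ≤ B ^ 2) :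
    Integrable (fun ω => ‖grCenter X x₁ μ T G (fun i t => ξ i t ω) (i + 1)
      - proxPoint X g μ (∑ j ∈ Finset.Icc 1 i, penalty μ j)
        (penaltySum X x₁ μ T G (fun i t => ξ i t ω) i)‖) Q ∧
    ∫ ω, ‖grCenter X x₁ μ T G (fun i t => ξ i t ω) (i + 1)
      - proxPoint X g μ (∑ j ∈ Finset.Icc 1 i, penalty μ j)
        (penaltySum X x₁ μ T G (fun i t => ξ i t ω) i)‖ ∂Q
      ≤ 2 * B / ((μ + ∑ j ∈ Finset.Icc 1 i, penalty μ j) * √((T : ℝ) + 1)) := by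
  have hne : X.Nonempty := ⟨x₁, hx₁⟩
  have hmem := fun ω => grCenter_mem (G := G) hne hc hconv hx₁ μ hT (fun i t => ξ i t ω)
  have hcm : ∀ t, ∀ j ≤ i, Measurable[sampleHistory ξ i t]
      fun ω => grCenter X x₁ μ T G (fun i t => ξ i t ω) j := fun t j hj =>
    @measurable_grCenter d S X U G Ω _ (sampleHistory ξ i t) hne hc hconv hG.subset hG.measurable
      x₁ hx₁ μ T hT ξ j fun k hk s => measurable_sampleHistory ξ (Or.inl (by omega))
  have hΛ : 0 ≤ ∑ j ∈ Finset.Icc 1 i, penalty μ j :=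
    Finset.sum_nonneg fun j _ => (penalty_pos hμ j).le
  simp only [grCenter_succ]
  exact hG.expectation_pssm hne hc hconv hXb hgc hg (by linarith)
    (fun t => sampleHistory_le hξ i t) (fun t => hcm t i le_rfl) (fun ω => hmem ω i)
    (fun t => @measurable_penaltySum d S X G Ω (sampleHistory ξ i t) x₁ μ T ξ i (hcm t))
    (fun t k hk => measurable_sampleHistory ξ (Or.inr ⟨rfl, hk⟩)) (hξ i) (hlaw i)
    (fun t => indep_sampleHistory hξ hind i t)
    (fun ω x hx => norm_sum_penalty_smul_sub_le hXb hD hμ i (hmem ω) hx) hB hRB hT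

end GradualRegularization

end GradReg

end

/-! ### Assembly of the bound. -/

theorem mainTheorem2 {d : ℕ}
    (X : Set (EuclideanSpace ℝ (Fin d))) (hXclosed : IsClosed X) (hXconv : Convex ℝ X)
    (D : ℝ) (hD : 0 < D) (hXbdd : Bornology.IsBounded X) (hXdiam : Metric.diam X ≤ D)
    (g : EuclideanSpace ℝ (Fin d) → ℝ) (hgconv : ConvexOn ℝ Set.univ g)
    (hgLip : ∃ K : NNReal, LipschitzWith K g)
    (μ : ℝ) (hμ : 0 < μ) (hgstrong : StrongConvexOn X μ g)
    {S : Type*} [MeasurableSpace S] (P : Measure S) [IsProbabilityMeasure P]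
    (U : Set (EuclideanSpace ℝ (Fin d)))
    (G : EuclideanSpace ℝ (Fin d) → S → EuclideanSpace ℝ (Fin d))
    (L : ℝ) (hL : 0 ≤ L) (hG : GradReg.IsStochasticOracle P X U g G L)
    {Ω : Type*} [MeasurableSpace Ω] (Q : Measure Ω) [IsProbabilityMeasure Q]
    (ξ : ℕ → ℕ → Ω → S) (hξmeas : ∀ i t, Measurable (ξ i t))
    (hξlaw : ∀ i t, Q.map (ξ i t) = P)
    (hξindep : iIndepFun (fun p : ℕ × ℕ => ξ p.1 p.2) Q)
    (x₁ : EuclideanSpace ℝ (Fin d)) (hx₁ : x₁ ∈ X)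
    (lam : ℝ) (hlam : 0 < lam) (T : ℕ) (hT : 1 ≤ T)
    (N : ℕ) (hN : (N : ℝ) = Real.logb 2 (1 + lam / (2 * μ))) :
    -- the envelope is finite and differentiable, so that its gradient is meaningful
    (∀ x, GradReg.moreauEnvelope (GradReg.extendTop X g) (1 / (2 * lam)) x ≠ ⊤ ∧
      GradReg.moreauEnvelope (GradReg.extendTop X g) (1 / (2 * lam)) x ≠ ⊥) ∧
    Differentiable ℝ
      (fun x => (GradReg.moreauEnvelope (GradReg.extendTop X g) (1 / (2 * lam)) x).toReal) ∧
    Integrable (fun ω => ‖gradient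
        (fun x => (GradReg.moreauEnvelope (GradReg.extendTop X g) (1 / (2 * lam)) x).toReal)
        (GradReg.gradualReg X x₁ μ lam T N G (fun i t => ξ i t ω))‖) Q ∧
    ∫ ω, ‖gradient
        (fun x => (GradReg.moreauEnvelope (GradReg.extendTop X g) (1 / (2 * lam)) x).toReal)
        (GradReg.gradualReg X x₁ μ lam T N G (fun i t => ξ i t ω))‖ ∂Q
      ≤ 14 * √2 * Real.logb 2 (1 + lam / (2 * μ)) * √(L ^ 2 + D ^ 2 * lam ^ 2) / √((T : ℝ) + 1) := by
  open GradReg in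
  have hne : X.Nonempty := ⟨x₁, hx₁⟩
  have hXc : IsCompact X := Metric.isCompact_of_isClosed_isBounded hXclosed hXbdd
  obtain ⟨K, hK⟩ := hgLip
  have hgc : Continuous g := hK.continuous
  have hgrad := fun x => hasGradientAt_moreauEnvelope hne hXc hgc hgstrong hμ hlam x
  have hpow : (2 : ℝ) ^ N = 1 + lam / (2 * μ) := by
    rw [← Real.rpow_natCast, hN]
    exact Real.rpow_logb two_pos (by norm_num) (by positivity)
  have hsum : ∑ j ∈ Finset.Icc 1 N, penalty μ j = lam := by
    rw [sum_Icc_penalty, hpow]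
    field_simp
    ring
  -- Needed to absorb the last-stage term into a multiple of `N`.
  have hN1 : (1 : ℝ) ≤ N := by
    have : N ≠ 0 := by
      rintro rfl
      have : 0 < lam / (2 * μ) := by positivity
      rw [pow_zero] at hpow
      linarith
    exact_mod_cast Nat.one_le_iff_ne_zero.2 this
  set C := √(L ^ 2 + D ^ 2 * lam ^ 2) with hC
  have hCpos : 0 < C := Real.sqrt_pos.2 (by positivity)
  have hBpos : 0 < √2 * C := by positivity
  have hB2 : (√2 * C) ^ 2 = 2 * (L ^ 2 + D ^ 2 * lam ^ 2) := by
    rw [mul_pow, Real.sq_sqrt zero_le_two, Real.sq_sqrt (by positivity)]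
  -- One constant `√2 * C` serves all stages, as partial penalty sums are at most `lam`.
  have hstage : ∀ i ≤ N, _ := fun i (hi : i ≤ N) =>
    hG.expectation_stage hXclosed hXconv hXbdd hXdiam hgc hμ hgstrong hξmeas hξlaw hξindep hx₁ hT
      i hBpos (by
        rw [hB2, mul_pow, mul_comm (_ ^ 2) (D ^ 2)]
        have h0 : 0 ≤ ∑ j ∈ Finset.Icc 1 i, penalty μ j :=
          Finset.sum_nonneg fun j _ => (penalty_pos hμ j).le
        have h1 : ∑ j ∈ Finset.Icc 1 i, penalty μ j ≤ lam := hsum ▸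
          Finset.sum_le_sum_of_subset_of_nonneg (Finset.Icc_subset_Icc_right hi)
            fun j _ _ => (penalty_pos hμ j).le
        gcongr)
  set e : ℕ → Ω → ℝ := fun i ω => ‖grCenter X x₁ μ T G (fun i t => ξ i t ω) (i + 1)
      - proxPoint X g μ (∑ j ∈ Finset.Icc 1 i, penalty μ j)
        (penaltySum X x₁ μ T G (fun i t => ξ i t ω) i)‖ with he
  have hei : ∀ i ≤ N, Integrable (e i) Q := fun i hi => (hstage i hi).1
  have hpath := fun ω => norm_gradient_gradualReg_le (G := G) (T := T) hXclosed hXbdd hgc hμ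
    hlam hgstrong hx₁ hsum (fun i t => ξ i t ω)
  have hi1 : Integrable (fun ω => lam * e N ω) Q := (hei N le_rfl).const_mul lam
  have hi2 : ∀ i ∈ Finset.range N, Integrable (fun ω => penalty μ (i + 1) * e i ω) Q :=
    fun i hi => (hei i (Finset.mem_range.1 hi).le).const_mul _
  have hi3 : Integrable (fun ω => 2 * ∑ i ∈ Finset.range N, penalty μ (i + 1) * e i ω) Q :=
    (integrable_finsetSum _ hi2).const_mul 2
  have hcm : ∀ i, Measurable fun ω => grCenter X x₁ μ T G (fun i t => ξ i t ω) i := fun i =>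
    measurable_grCenter hne hXclosed hXconv hG.subset hG.measurable hx₁ μ hT i
      fun j _ t => hξmeas j t
  have hout : Measurable fun ω => gradualReg X x₁ μ lam T N G (fun i t => ξ i t ω) := by
    have h2 : Measurable fun ω => penaltySum X x₁ μ T G (fun i t => ξ i t ω) N :=
      measurable_penaltySum fun j _ => hcm j
    exact (((hcm (N + 1)).const_smul lam).add h2).const_smul
      (1 / (lam + ∑ i ∈ Finset.Icc 1 N, penalty μ i))
  have hgc' : Continuous (gradient
      (fun x => (moreauEnvelope (extendTop X g) (1 / (2 * lam)) x).toReal)) := by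
    rw [funext fun x => (hgrad x).gradient]
    have := continuous_proxPoint hne hXc hgc hgstrong (by linarith : 0 < μ + 2 * lam)
    fun_prop
  have hint : Integrable (fun ω => ‖gradient
      (fun x => (moreauEnvelope (extendTop X g) (1 / (2 * lam)) x).toReal)
      (gradualReg X x₁ μ lam T N G (fun i t => ξ i t ω))‖) Q :=
    Integrable.mono' (hi1.add hi3) (hgc'.measurable.comp hout).norm.aestronglyMeasurable
      (Filter.Eventually.of_forall fun ω => by rw [norm_norm]; exact hpath ω)
  refine ⟨fun x => ?_, fun x => (hgrad x).hasFDerivAt.differentiableAt, hint, ?_⟩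
  · rw [moreauEnvelope_eq_of_isProxPoint hμ hlam
      (isProxPoint_proxPoint hne hXc hgc hgstrong ((2 * lam) • x))]
    exact ⟨EReal.coe_ne_top _, EReal.coe_ne_bot _⟩
  rw [← hN]
  set A := 2 * (√2 * C) / √((T : ℝ) + 1) with hA
  have hApos : 0 < A := by positivity
  have hlast : lam * ∫ ω, e N ω ∂Q ≤ A := by
    have h : ∫ ω, e N ω ∂Q ≤ _ := (hstage N le_rfl).2
    rw [hsum, ← div_div, div_right_comm] at h
    refine (mul_le_mul_of_nonneg_left h hlam.le).trans ?_
    rw [mul_div_assoc', div_le_iff₀ (by positivity)]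
    nlinarith
  have hterm : ∀ i ∈ Finset.range N, penalty μ (i + 1) * ∫ ω, e i ω ∂Q ≤ 2 * A := by
    intro i hi
    have h : ∫ ω, e i ω ∂Q ≤ _ := (hstage i (Finset.mem_range.1 hi).le).2
    rw [← div_div, div_right_comm] at h
    refine (mul_le_mul_of_nonneg_left h (penalty_pos hμ _).le).trans ?_
    have h1 : (1 : ℝ) ≤ 2 ^ i := one_le_pow₀ one_le_two
    -- Geometric growth: the next penalty is comparable to the curvature already present, which
    -- cancels the denominator of the stage error.
    have h2 : penalty μ (i + 1) ≤ 2 * (μ + ∑ j ∈ Finset.Icc 1 i, penalty μ j) := by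
      rw [sum_Icc_penalty, penalty, pow_succ]
      nlinarith
    have h3 : 0 < μ + ∑ j ∈ Finset.Icc 1 i, penalty μ j := by
      linarith [penalty_pos hμ (i + 1)]
    rw [mul_div_assoc', div_le_iff₀ h3]
    nlinarith
  calc _ ≤ ∫ ω, (lam * e N ω + 2 * ∑ i ∈ Finset.range N, penalty μ (i + 1) * e i ω) ∂Q :=
        integral_mono hint (hi1.add hi3) hpath
    _ = lam * ∫ ω, e N ω ∂Q + 2 * ∑ i ∈ Finset.range N, penalty μ (i + 1) * ∫ ω, e i ω ∂Q := by
        rw [integral_add hi1 hi3, integral_const_mul, integral_const_mul,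
          integral_finsetSum _ hi2]
        simp only [integral_const_mul]
    _ ≤ A + 2 * ∑ i ∈ Finset.range N, 2 * A :=
        add_le_add hlast (mul_le_mul_of_nonneg_left (Finset.sum_le_sum hterm) zero_le_two)
    _ = (1 + 4 * N) * A := by
        rw [Finset.sum_const, Finset.card_range, nsmul_eq_mul]
        ring
    -- Since `N ≥ 1`, even `5 * N` would do; `7` matches the stated `14 * √2`.
    _ ≤ 7 * N * A := by
        gcongr
        linarith
    _ = _ := by
        rw [hA]
        ring
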